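/- **Conventions.** A double category $\mathbb D$ is a pseudo double category: it has a category $\mathbb D_0$ of objects and arrows, a category $\mathbb D_1$ of proarrows $m : x \nrightarrow y$ and cells, source and target functors $\mathbb D_1\rightrightarrows\mathbb D_0$, and external composition $\odot$ (in diagrammatic order) and identities $\mathrm{id}$, unital and associative up to coherent isomorphism. For a span of sets $I\xleftarrow{\ell} A\xrightarrow{r} J$ write $a : i \nrightarrow j$ for an element $a\in A$ with $\ell(a)=i$, $r(a)=j$. The double category $\mathbb{F}\mathsf{am}^*(\mathbb D)$ of contravariant families has: as objects, families $\vec x=(x_i)_{i\in I}$ of objects of $\mathbb D$ indexed by a set; as arrows $(I,\vec x)\to(J,\vec y)$, a function $f_0:J\to I$ with arrows $f_j:x_{f_0(j)}\to y_j$; as proarrows $(I,\vec x) \nrightarrow (J,\vec y)$, a span of sets $I\leftarrow A\to J$ with proarrows $m_a:x_i \nrightarrow y_j$ for $a:i \nrightarrow j$; as cells from $(A,\vec m)$ to $(B,\vec n)$ with boundaries $(f_0,f)$ and $(g_0,g)$, a map of spans $\alpha_0:B\to A$ over $f_0$ and $g_0$ with cells $\alpha_b : m_{\alpha_0(b)}\to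 n_b$ with boundaries $f_k$ and $g_l$ for $b:k \nrightarrow l$. Spans are composed by pullback, and families of proarrows componentwise. Let $\Delta:\mathbb D\to\mathbb{F}\mathsf{am}^*(\mathbb D)$ send everything to singleton families. * A *choice of lax products* in $\mathbb D$ (which *has lax products* if there is one) is a lax right adjoint $\Pi$ of $\Delta$ (in the 2-category of double categories, lax double functors and natural transformations). The products are *iso-strong* if the comparison cells $\mathrm{id}_{\Pi\vec x}\to\Pi(\mathrm{id}_{\vec x})$ are isomorphisms for all $\vec x$, and the comparison cells $\Pi\vec m\odot\Pi\vec n\to\Pi(\vec m\odot\vec n)$ are isomorphisms whenever $\vec m$ and $\vec n$ are composable and indexed by spans $I\leftarrow A\to J$ and $J\leftarrow B\to K$ such that $A\to J$ and $B\to J$ are bijections. $\mathbb D$ *has iso-strong products* if it has iso-strong lax products. * A *choice of lax parallel products* is a lax right adjoint $\Pi_I$ of the diagonal $\mathbb D\to\mathbb D^I$ for every set $I$; the parallel products are *strong* if every $\Pi_I$ is pseudo. We write $\Pi\vec x = \Pi_I\vec x$, and similarly for families $(m_i : x_i \nrightarrow y_i)_{i\in I}$ of proarrows. * Given such a choice,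 a function $f:K\to I$ and a family $\vec x=(x_i)_{i\in I}$, the *structure arrow* $\Pi(f):\Pi\vec x\to\Pi(f^*\vec x)$, where $f^*\vec x=(x_{f(k)})_{k\in K}$, is the arrow whose $k$-th component is the projection $\pi_{f(k)}$. The choice *has restrictions along structure arrows* if for all functions $I\xleftarrow{f}K\xrightarrow{g}J$, all families of objects $\vec x$ over $I$ and $\vec y$ over $J$, and all families of proarrows $m_k:x_{f(k)} \nrightarrow y_{g(k)}$ ($k\in K$), the parallel product $\Pi\vec m:\Pi f^*\vec x \nrightarrow \Pi g^*\vec y$ has a restriction (cartesian cell) along $\Pi(f)$ and $\Pi(g)$. For the *finite* versions, all indexing sets, including the apexes of the indexing spans, are finite. A double category with strong finite parallel products is *cartesian*. **Theorem (Double products via restrictions).** Let $\mathbb D$ be a double category. Each of the following holds both for arbitrary (small) products and for finite products. 1. $\mathbb D$ has lax (finite) products if and only if it has a choice of lax (finite) parallel products that has restrictions along structure arrows. 2. For any choice of lax (finite) products and any choice of lax (finite) parallel products in $\mathbb D$, the products are iso-strong if and only if the parallel products are strong. 3. Consequently, $\mathbb D$ has iso-strong (finite) products if and only if it has a choice of strong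 (finite) parallel products that has restrictions along structure arrows. In the finite case: the double categories with iso-strong finite products are exactly the cartesian double categories having these restrictions. -/

import Mathlib

open CategoryTheory

universe w c p v u c₁ p₁ v₁ u₁ c₂ p₂ v₂ u₂ c₃ p₃ v₃ u₃

namespace Dbl

/-! ### Double categories -/

/-- For every two objects `x`, `y` of `D`, a type of proarrows from `x` to `y`. -/
class HasPro (D : Type u) where
  /-- The proarrows from one object to another. -/
  Pro : D → D → Type p

/-- All proarrows of `D`, bundled with their source and target. These are the objects of the
category `D₁` of proarrows and cells. -/
structure Proarrow (D : Type u) [HasPro.{p} D] where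
  {src : D}
  {tgt : D}
  pro : HasPro.Pro src tgt

/-- A (pseudo) double category. The category `D₀` of objects and arrows is the category structure
on `D`; the category `D₁` of proarrows and cells is a category structure on `Proarrow D`. A cell
`α : m ⟶ n` has a left and a right arrow as its boundary, functorially. The external composition
`pcomp` (in diagrammatic order) and the external identities `unit` are functors, unital and
associative up to coherent natural isomorphisms with identity boundaries. The external composite
`hcomp α β h` of two cells is defined when the right boundary of `α` is the left boundary
of `β`. -/
class DoubleCategory (D : Type u) extends Category.{v} D, HasPro.{p} D where
  [cells : Category.{c} (Proarrow D)]
  /-- The left boundary of a cell (the source functor on cells). -/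
  left : ∀ {M N : Proarrow D}, (M ⟶ N) → (M.src ⟶ N.src)
  /-- The right boundary of a cell (the target functor on cells). -/
  right : ∀ {M N : Proarrow D}, (M ⟶ N) → (M.tgt ⟶ N.tgt)
  left_id : ∀ M : Proarrow D, left (𝟙 M) = 𝟙 M.src
  right_id : ∀ M : Proarrow D, right (𝟙 M) = 𝟙 M.tgt
  left_comp : ∀ {M N P : Proarrow D} (α : M ⟶ N) (β : N ⟶ P),
    left (α ≫ β) = left α ≫ left β
  right_comp : ∀ {M N P : Proarrow D} (α : M ⟶ N) (β : N ⟶ P),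
    right (α ≫ β) = right α ≫ right β
  /-- External composition of proarrows, in diagrammatic order. -/
  pcomp : ∀ {x y z : D}, HasPro.Pro x y → HasPro.Pro y z → HasPro.Pro x z
  /-- External composition of cells. -/
  hcomp : ∀ {x y z x₁ y₁ z₁ : D} {m : HasPro.Pro x y} {n : HasPro.Pro y z} {m₁ : HasPro.Pro x₁ y₁} {n₁ : HasPro.Pro y₁ z₁}
    (α : Proarrow.mk m ⟶ Proarrow.mk m₁) (β : Proarrow.mk n ⟶ Proarrow.mk n₁),
    right α = left β → (Proarrow.mk (pcomp m n) ⟶ Proarrow.mk (pcomp m₁ n₁))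
  left_hcomp : ∀ {x y z x₁ y₁ z₁ : D} {m : HasPro.Pro x y} {n : HasPro.Pro y z} {m₁ : HasPro.Pro x₁ y₁}
    {n₁ : HasPro.Pro y₁ z₁} (α : Proarrow.mk m ⟶ Proarrow.mk m₁) (β : Proarrow.mk n ⟶ Proarrow.mk n₁)
    (h : right α = left β), left (hcomp α β h) = left α
  right_hcomp : ∀ {x y z x₁ y₁ z₁ : D} {m : HasPro.Pro x y} {n : HasPro.Pro y z} {m₁ : HasPro.Pro x₁ y₁}
    {n₁ : HasPro.Pro y₁ z₁} (α : Proarrow.mk m ⟶ Proarrow.mk m₁) (β : Proarrow.mk n ⟶ Proarrow.mk n₁)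
    (h : right α = left β), right (hcomp α β h) = right β
  hcomp_id : ∀ {x y z : D} (m : HasPro.Pro x y) (n : HasPro.Pro y z),
    hcomp (𝟙 (Proarrow.mk m)) (𝟙 (Proarrow.mk n)) (by rw [left_id, right_id]) =
      𝟙 (Proarrow.mk (pcomp m n))
  hcomp_comp : ∀ {x y z x₁ y₁ z₁ x₂ y₂ z₂ : D} {m : HasPro.Pro x y} {n : HasPro.Pro y z} {m₁ : HasPro.Pro x₁ y₁}
    {n₁ : HasPro.Pro y₁ z₁} {m₂ : HasPro.Pro x₂ y₂} {n₂ : HasPro.Pro y₂ z₂}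
    (α : Proarrow.mk m ⟶ Proarrow.mk m₁) (β : Proarrow.mk n ⟶ Proarrow.mk n₁)
    (γ : Proarrow.mk m₁ ⟶ Proarrow.mk m₂) (δ : Proarrow.mk n₁ ⟶ Proarrow.mk n₂)
    (h : right α = left β) (k : right γ = left δ),
    hcomp (α ≫ γ) (β ≫ δ) (by rw [left_comp, right_comp, h, k]) = hcomp α β h ≫ hcomp γ δ k
  /-- The external identity proarrow on an object. -/
  unit : ∀ x : D, HasPro.Pro x x
  /-- The external identity cell on an arrow. -/
  unitCell : ∀ {x y : D}, (x ⟶ y) → (Proarrow.mk (unit x) ⟶ Proarrow.mk (unit y))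
  left_unitCell : ∀ {x y : D} (f : x ⟶ y), left (unitCell f) = f
  right_unitCell : ∀ {x y : D} (f : x ⟶ y), right (unitCell f) = f
  unitCell_id : ∀ x : D, unitCell (𝟙 x) = 𝟙 (Proarrow.mk (unit x))
  unitCell_comp : ∀ {x y z : D} (f : x ⟶ y) (g : y ⟶ z),
    unitCell (f ≫ g) = unitCell f ≫ unitCell g
  /-- The associators. -/
  associator : ∀ {x y z t : D} (m : HasPro.Pro x y) (n : HasPro.Pro y z) (q : HasPro.Pro z t),
    Proarrow.mk (pcomp (pcomp m n) q) ≅ Proarrow.mk (pcomp m (pcomp n q))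
  left_associator : ∀ {x y z t : D} (m : HasPro.Pro x y) (n : HasPro.Pro y z) (q : HasPro.Pro z t),
    left (associator m n q).hom = 𝟙 x
  right_associator : ∀ {x y z t : D} (m : HasPro.Pro x y) (n : HasPro.Pro y z) (q : HasPro.Pro z t),
    right (associator m n q).hom = 𝟙 t
  associator_naturality : ∀ {x y z t x₁ y₁ z₁ t₁ : D} {m : HasPro.Pro x y} {n : HasPro.Pro y z} {q : HasPro.Pro z t}
    {m₁ : HasPro.Pro x₁ y₁} {n₁ : HasPro.Pro y₁ z₁} {q₁ : HasPro.Pro z₁ t₁}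
    (α : Proarrow.mk m ⟶ Proarrow.mk m₁) (β : Proarrow.mk n ⟶ Proarrow.mk n₁)
    (γ : Proarrow.mk q ⟶ Proarrow.mk q₁) (h : right α = left β) (k : right β = left γ),
    hcomp (hcomp α β h) γ (by rw [right_hcomp, k]) ≫ (associator m₁ n₁ q₁).hom =
      (associator m n q).hom ≫ hcomp α (hcomp β γ k) (by rw [left_hcomp, h])
  /-- The left unitors. -/
  leftUnitor : ∀ {x y : D} (m : HasPro.Pro x y), Proarrow.mk (pcomp (unit x) m) ≅ Proarrow.mk m
  left_leftUnitor : ∀ {x y : D} (m : HasPro.Pro x y), left (leftUnitor m).hom = 𝟙 x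
  right_leftUnitor : ∀ {x y : D} (m : HasPro.Pro x y), right (leftUnitor m).hom = 𝟙 y
  leftUnitor_naturality : ∀ {x y x₁ y₁ : D} {m : HasPro.Pro x y} {m₁ : HasPro.Pro x₁ y₁}
    (α : Proarrow.mk m ⟶ Proarrow.mk m₁),
    hcomp (unitCell (left α)) α (right_unitCell _) ≫ (leftUnitor m₁).hom =
      (leftUnitor m).hom ≫ α
  /-- The right unitors. -/
  rightUnitor : ∀ {x y : D} (m : HasPro.Pro x y), Proarrow.mk (pcomp m (unit y)) ≅ Proarrow.mk m
  left_rightUnitor : ∀ {x y : D} (m : HasPro.Pro x y), left (rightUnitor m).hom = 𝟙 x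
  right_rightUnitor : ∀ {x y : D} (m : HasPro.Pro x y), right (rightUnitor m).hom = 𝟙 y
  rightUnitor_naturality : ∀ {x y x₁ y₁ : D} {m : HasPro.Pro x y} {m₁ : HasPro.Pro x₁ y₁}
    (α : Proarrow.mk m ⟶ Proarrow.mk m₁),
    hcomp α (unitCell (right α)) (left_unitCell _).symm ≫ (rightUnitor m₁).hom =
      (rightUnitor m).hom ≫ α
  pentagon : ∀ {x y z t s : D} (m : HasPro.Pro x y) (n : HasPro.Pro y z) (q : HasPro.Pro z t) (r : HasPro.Pro t s),
    hcomp (associator m n q).hom (𝟙 (Proarrow.mk r)) (by rw [right_associator, left_id]) ≫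
        (associator m (pcomp n q) r).hom ≫
        hcomp (𝟙 (Proarrow.mk m)) (associator n q r).hom (by rw [left_associator, right_id]) =
      (associator (pcomp m n) q r).hom ≫ (associator m n (pcomp q r)).hom
  triangle : ∀ {x y z : D} (m : HasPro.Pro x y) (n : HasPro.Pro y z),
    (associator m (unit y) n).hom ≫
        hcomp (𝟙 (Proarrow.mk m)) (leftUnitor n).hom (by rw [left_leftUnitor, right_id]) =
      hcomp (rightUnitor m).hom (𝟙 (Proarrow.mk n)) (by rw [right_rightUnitor, left_id])

attribute [reducible, instance] DoubleCategory.cells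

attribute [simp] DoubleCategory.left_id DoubleCategory.right_id DoubleCategory.left_comp
  DoubleCategory.right_comp DoubleCategory.left_hcomp DoubleCategory.right_hcomp
  DoubleCategory.hcomp_id DoubleCategory.left_unitCell DoubleCategory.right_unitCell
  DoubleCategory.unitCell_id DoubleCategory.left_associator DoubleCategory.right_associator
  DoubleCategory.left_leftUnitor DoubleCategory.right_leftUnitor
  DoubleCategory.left_rightUnitor DoubleCategory.right_rightUnitor

open HasPro DoubleCategory

section Boundaries

variable {D : Type u} [DoubleCategory.{c, p, v} D]

theorem left_inv_eq_id {x y : D} {m n : Pro x y} (e : Proarrow.mk m ≅ Proarrow.mk n)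
    (h : left e.hom = 𝟙 x) : left e.inv = 𝟙 x := by
  have := congrArg left e.hom_inv_id
  rw [left_comp, h, left_id] at this
  exact (Category.id_comp _).symm.trans this

theorem right_inv_eq_id {x y : D} {m n : Pro x y} (e : Proarrow.mk m ≅ Proarrow.mk n)
    (h : right e.hom = 𝟙 y) : right e.inv = 𝟙 y := by
  have := congrArg right e.hom_inv_id
  rw [right_comp, h, right_id] at this
  exact (Category.id_comp _).symm.trans this

theorem leftUnitor_naturality_of_eq {x y x₁ y₁ : D} {m : Pro x y} {n : Pro x₁ y₁}
    (α : Proarrow.mk m ⟶ Proarrow.mk n) {f : x ⟶ x₁} (h : left α = f) :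
    hcomp (unitCell f) α ((right_unitCell f).trans h.symm) ≫ (leftUnitor n).hom =
      (leftUnitor m).hom ≫ α := by
  subst h
  exact leftUnitor_naturality α

theorem rightUnitor_naturality_of_eq {x y x₁ y₁ : D} {m : Pro x y} {n : Pro x₁ y₁}
    (α : Proarrow.mk m ⟶ Proarrow.mk n) {f : y ⟶ y₁} (h : right α = f) :
    hcomp α (unitCell f) (h.trans (left_unitCell f).symm) ≫ (rightUnitor n).hom =
      (rightUnitor m).hom ≫ α := by
  subst h
  exact rightUnitor_naturality α

end Boundaries

/-! ### Lax double functors, their transformations, and adjunctions -/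

/-- A lax double functor. -/
structure LaxFunctor (D : Type u₁) [DoubleCategory.{c₁, p₁, v₁} D]
    (E : Type u₂) [DoubleCategory.{c₂, p₂, v₂} E] extends D ⥤ E where
  /-- The action on proarrows. -/
  pro : ∀ {x y : D}, Pro x y → Pro (obj x) (obj y)
  /-- The action on cells. -/
  cell : ∀ {x y x₁ y₁ : D} {m : Pro x y} {n : Pro x₁ y₁},
    (Proarrow.mk m ⟶ Proarrow.mk n) → (Proarrow.mk (pro m) ⟶ Proarrow.mk (pro n))
  left_cell : ∀ {x y x₁ y₁ : D} {m : Pro x y} {n : Pro x₁ y₁}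
    (α : Proarrow.mk m ⟶ Proarrow.mk n), left (cell α) = map (left α)
  right_cell : ∀ {x y x₁ y₁ : D} {m : Pro x y} {n : Pro x₁ y₁}
    (α : Proarrow.mk m ⟶ Proarrow.mk n), right (cell α) = map (right α)
  cell_id : ∀ {x y : D} (m : Pro x y), cell (𝟙 (Proarrow.mk m)) = 𝟙 (Proarrow.mk (pro m))
  cell_comp : ∀ {x y x₁ y₁ x₂ y₂ : D} {m : Pro x y} {n : Pro x₁ y₁} {q : Pro x₂ y₂}
    (α : Proarrow.mk m ⟶ Proarrow.mk n) (β : Proarrow.mk n ⟶ Proarrow.mk q),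
    cell (α ≫ β) = cell α ≫ cell β
  /-- The composition comparison cells. -/
  laxator : ∀ {x y z : D} (m : Pro x y) (n : Pro y z),
    Proarrow.mk (pcomp (pro m) (pro n)) ⟶ Proarrow.mk (pro (pcomp m n))
  left_laxator : ∀ {x y z : D} (m : Pro x y) (n : Pro y z), left (laxator m n) = 𝟙 (obj x)
  right_laxator : ∀ {x y z : D} (m : Pro x y) (n : Pro y z), right (laxator m n) = 𝟙 (obj z)
  laxator_naturality : ∀ {x y z x₁ y₁ z₁ : D} {m : Pro x y} {n : Pro y z} {m₁ : Pro x₁ y₁}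
    {n₁ : Pro y₁ z₁} (α : Proarrow.mk m ⟶ Proarrow.mk m₁) (β : Proarrow.mk n ⟶ Proarrow.mk n₁)
    (h : right α = left β),
    hcomp (cell α) (cell β) (by rw [left_cell, right_cell, h]) ≫ laxator m₁ n₁ =
      laxator m n ≫ cell (hcomp α β h)
  /-- The identity comparison cells. -/
  laxUnit : ∀ x : D, Proarrow.mk (unit (obj x)) ⟶ Proarrow.mk (pro (unit x))
  left_laxUnit : ∀ x : D, left (laxUnit x) = 𝟙 (obj x)
  right_laxUnit : ∀ x : D, right (laxUnit x) = 𝟙 (obj x)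
  laxUnit_naturality : ∀ {x y : D} (f : x ⟶ y),
    unitCell (map f) ≫ laxUnit y = laxUnit x ≫ cell (unitCell f)
  laxator_assoc : ∀ {x y z t : D} (m : Pro x y) (n : Pro y z) (q : Pro z t),
    hcomp (laxator m n) (𝟙 (Proarrow.mk (pro q))) (by rw [right_laxator, left_id]) ≫
        laxator (pcomp m n) q ≫ cell (associator m n q).hom =
      (associator (pro m) (pro n) (pro q)).hom ≫
        hcomp (𝟙 (Proarrow.mk (pro m))) (laxator n q) (by rw [left_laxator, right_id]) ≫
        laxator m (pcomp n q)
  laxator_leftUnit : ∀ {x y : D} (m : Pro x y),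
    hcomp (laxUnit x) (𝟙 (Proarrow.mk (pro m))) (by rw [right_laxUnit, left_id]) ≫
        laxator (unit x) m ≫ cell (leftUnitor m).hom =
      (leftUnitor (pro m)).hom
  laxator_rightUnit : ∀ {x y : D} (m : Pro x y),
    hcomp (𝟙 (Proarrow.mk (pro m))) (laxUnit y) (by rw [left_laxUnit, right_id]) ≫
        laxator m (unit y) ≫ cell (rightUnitor m).hom =
      (rightUnitor (pro m)).hom

attribute [simp] LaxFunctor.left_cell LaxFunctor.right_cell LaxFunctor.cell_id
  LaxFunctor.left_laxator LaxFunctor.right_laxator LaxFunctor.left_laxUnit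
  LaxFunctor.right_laxUnit

namespace LaxFunctor

/-- A lax double functor is pseudo if its comparison cells are isomorphisms in the category of
proarrows and cells. -/
def IsPseudo {D : Type u₁} [DoubleCategory.{c₁, p₁, v₁} D]
    {E : Type u₂} [DoubleCategory.{c₂, p₂, v₂} E] (F : LaxFunctor D E) : Prop :=
  (∀ {x y z : D} (m : Pro x y) (n : Pro y z), IsIso (F.laxator m n)) ∧
    ∀ x : D, IsIso (F.laxUnit x)

/-- The identity double functor. -/
abbrev identity (D : Type u₁) [DoubleCategory.{c₁, p₁, v₁} D] : LaxFunctor D D where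
  obj x := x
  map f := f
  map_id _ := rfl
  map_comp _ _ := rfl
  pro m := m
  cell α := α
  left_cell _ := rfl
  right_cell _ := rfl
  cell_id _ := rfl
  cell_comp _ _ := rfl
  laxator m n := 𝟙 (Proarrow.mk (pcomp m n))
  left_laxator m n := left_id (Proarrow.mk (pcomp m n))
  right_laxator m n := right_id (Proarrow.mk (pcomp m n))
  laxator_naturality α β h := by simp
  laxUnit x := 𝟙 (Proarrow.mk (unit x))
  left_laxUnit x := left_id (Proarrow.mk (unit x))
  right_laxUnit x := right_id (Proarrow.mk (unit x))
  laxUnit_naturality f := by simp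
  laxator_assoc m n q := by simp
  laxator_leftUnit m := by simp
  laxator_rightUnit m := by simp

/-- The composite (in diagrammatic order) of lax double functors. -/
abbrev compose {D : Type u₁} [DoubleCategory.{c₁, p₁, v₁} D]
    {E : Type u₂} [DoubleCategory.{c₂, p₂, v₂} E]
    {B : Type u₃} [DoubleCategory.{c₃, p₃, v₃} B]
    (F : LaxFunctor D E) (G : LaxFunctor E B) : LaxFunctor D B where
  obj x := G.obj (F.obj x)
  map f := G.map (F.map f)
  map_id x := by rw [F.map_id, G.map_id]
  map_comp f g := by rw [F.map_comp, G.map_comp]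
  pro m := G.pro (F.pro m)
  cell α := G.cell (F.cell α)
  left_cell α := by simp
  right_cell α := by simp
  cell_id m := by simp
  cell_comp α β := by simp [LaxFunctor.cell_comp]
  laxator m n := G.laxator (F.pro m) (F.pro n) ≫ G.cell (F.laxator m n)
  left_laxator m n := by simp
  right_laxator m n := by simp
  laxator_naturality α β h := by
    rw [← Category.assoc, G.laxator_naturality _ _ (by simp [h]), Category.assoc, Category.assoc,
      ← G.cell_comp, ← G.cell_comp, F.laxator_naturality]
  laxUnit x := G.laxUnit (F.obj x) ≫ G.cell (F.laxUnit x)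
  left_laxUnit x := by simp
  right_laxUnit x := by simp
  laxUnit_naturality f := by
    simp only [← Category.assoc, G.laxUnit_naturality]
    simp only [Category.assoc, ← G.cell_comp, F.laxUnit_naturality]
  laxator_assoc m n q := by
    have e₁ : hcomp (G.laxator (F.pro m) (F.pro n) ≫ G.cell (F.laxator m n))
        (𝟙 (Proarrow.mk (G.pro (F.pro q)))) (by simp) =
        hcomp (G.laxator (F.pro m) (F.pro n)) (𝟙 (Proarrow.mk (G.pro (F.pro q)))) (by simp) ≫
        hcomp (G.cell (F.laxator m n)) (G.cell (𝟙 (Proarrow.mk (F.pro q)))) (by simp) := by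
      rw [← hcomp_comp]; simp
    have e₂ : hcomp (𝟙 (Proarrow.mk (G.pro (F.pro m))))
        (G.laxator (F.pro n) (F.pro q) ≫ G.cell (F.laxator n q)) (by simp) =
        hcomp (𝟙 (Proarrow.mk (G.pro (F.pro m)))) (G.laxator (F.pro n) (F.pro q)) (by simp) ≫
        hcomp (G.cell (𝟙 (Proarrow.mk (F.pro m)))) (G.cell (F.laxator n q)) (by simp) := by
      rw [← hcomp_comp]; simp
    rw [e₁, e₂]
    simp only [Category.assoc]
    rw [← Category.assoc (hcomp (G.cell (F.laxator m n)) _ _),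
      ← Category.assoc (hcomp (G.cell (𝟙 (Proarrow.mk (F.pro m)))) _ _),
      G.laxator_naturality _ _ (by simp), G.laxator_naturality _ _ (by simp)]
    simp only [Category.assoc, ← G.cell_comp, F.laxator_assoc]
    simp only [G.cell_comp]
    rw [← Category.assoc (G.laxator _ _), ← Category.assoc (hcomp _ _ _),
      G.laxator_assoc]
    simp only [Category.assoc]
  laxator_leftUnit m := by
    have e : hcomp (G.laxUnit (F.obj _) ≫ G.cell (F.laxUnit _))
        (𝟙 (Proarrow.mk (G.pro (F.pro m)))) (by simp) =
        hcomp (G.laxUnit (F.obj _)) (𝟙 (Proarrow.mk (G.pro (F.pro m)))) (by simp) ≫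
        hcomp (G.cell (F.laxUnit _)) (G.cell (𝟙 (Proarrow.mk (F.pro m)))) (by simp) := by
      rw [← hcomp_comp]; simp
    rw [← G.laxator_leftUnit, ← F.laxator_leftUnit, e]
    simp only [Category.assoc]
    rw [← Category.assoc (hcomp (G.cell (F.laxUnit _)) _ _), G.laxator_naturality _ _ (by simp)]
    simp only [Category.assoc, ← G.cell_comp]
  laxator_rightUnit m := by
    have e : hcomp (𝟙 (Proarrow.mk (G.pro (F.pro m))))
        (G.laxUnit (F.obj _) ≫ G.cell (F.laxUnit _)) (by simp) =
        hcomp (𝟙 (Proarrow.mk (G.pro (F.pro m)))) (G.laxUnit (F.obj _)) (by simp) ≫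
        hcomp (G.cell (𝟙 (Proarrow.mk (F.pro m)))) (G.cell (F.laxUnit _)) (by simp) := by
      rw [← hcomp_comp]; simp
    rw [← G.laxator_rightUnit, ← F.laxator_rightUnit, e]
    simp only [Category.assoc]
    rw [← Category.assoc (hcomp _ (G.cell (F.laxUnit _)) _), G.laxator_naturality _ _ (by simp)]
    simp only [Category.assoc, ← G.cell_comp]

end LaxFunctor

/-- A natural transformation of lax double functors (with arrows and cells as components). -/
structure LaxNatTrans {D : Type u₁} [DoubleCategory.{c₁, p₁, v₁} D]
    {E : Type u₂} [DoubleCategory.{c₂, p₂, v₂} E] (F G : LaxFunctor D E) where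
  /-- The component arrow at an object. -/
  app : ∀ x : D, F.obj x ⟶ G.obj x
  naturality : ∀ {x y : D} (f : x ⟶ y), F.map f ≫ app y = app x ≫ G.map f
  /-- The component cell at a proarrow. -/
  cell : ∀ {x y : D} (m : Pro x y), Proarrow.mk (F.pro m) ⟶ Proarrow.mk (G.pro m)
  left_cell : ∀ {x y : D} (m : Pro x y), left (cell m) = app x
  right_cell : ∀ {x y : D} (m : Pro x y), right (cell m) = app y
  cell_naturality : ∀ {x y x₁ y₁ : D} {m : Pro x y} {n : Pro x₁ y₁}
    (α : Proarrow.mk m ⟶ Proarrow.mk n), F.cell α ≫ cell n = cell m ≫ G.cell α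
  laxator_cell : ∀ {x y z : D} (m : Pro x y) (n : Pro y z),
    F.laxator m n ≫ cell (pcomp m n) =
      hcomp (cell m) (cell n) (by rw [left_cell, right_cell]) ≫ G.laxator m n
  laxUnit_cell : ∀ x : D, F.laxUnit x ≫ cell (unit x) = unitCell (app x) ≫ G.laxUnit x

/-- An adjunction `F ⊣ G` in the 2-category of double categories, lax double functors and natural
transformations: a unit and a counit that satisfy the triangle identities, on objects and on
proarrows. -/
structure DoubleAdjunction {D : Type u₁} [DoubleCategory.{c₁, p₁, v₁} D]
    {E : Type u₂} [DoubleCategory.{c₂, p₂, v₂} E] (F : LaxFunctor D E) (G : LaxFunctor E D) where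
  unit : LaxNatTrans (LaxFunctor.identity D) (F.compose G)
  counit : LaxNatTrans (G.compose F) (LaxFunctor.identity E)
  left_triangle : ∀ x : D, F.map (unit.app x) ≫ counit.app (F.obj x) = 𝟙 (F.obj x)
  left_triangle_cell : ∀ {x y : D} (m : Pro x y),
    F.cell (unit.cell m) ≫ counit.cell (F.pro m) = 𝟙 (Proarrow.mk (F.pro m))
  right_triangle : ∀ y : E, unit.app (G.obj y) ≫ G.map (counit.app y) = 𝟙 (G.obj y)
  right_triangle_cell : ∀ {x y : E} (n : Pro x y),
    unit.cell (G.pro n) ≫ G.cell (counit.cell n) = 𝟙 (Proarrow.mk (G.pro n))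

/-- A lax right adjoint of a double functor. -/
structure LaxRightAdjoint {D : Type u₁} [DoubleCategory.{c₁, p₁, v₁} D]
    {E : Type u₂} [DoubleCategory.{c₂, p₂, v₂} E] (F : LaxFunctor D E) where
  functor : LaxFunctor E D
  adj : DoubleAdjunction F functor

/-! ### Powers of a double category -/

section Power

variable {D : Type u} [DoubleCategory.{c, p, v} D] (I : Type w)

instance powerPro : HasPro.{max w p} (I → D) where
  Pro x y := ∀ i, Pro (x i) (y i)

instance powerCells : Category.{max w c} (Proarrow (I → D)) where
  Hom M N := ∀ i, Proarrow.mk (M.pro i) ⟶ Proarrow.mk (N.pro i)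
  id M i := 𝟙 (Proarrow.mk (M.pro i))
  comp α β i := α i ≫ β i
  id_comp α := funext fun i => Category.id_comp (α i)
  comp_id α := funext fun i => Category.comp_id (α i)
  assoc α β γ := funext fun i => Category.assoc (α i) (β i) (γ i)

/-- The double category `D ^ I`, with all operations componentwise. -/
instance power : DoubleCategory.{max w c, max w p, max w v} (I → D) where
  toCategory := CategoryTheory.pi fun _ => D
  toHasPro := powerPro I
  cells := powerCells I
  left α i := left (α i)
  right α i := right (α i)
  left_id M := funext fun i => left_id (Proarrow.mk (M.pro i))
  right_id M := funext fun i => right_id (Proarrow.mk (M.pro i))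
  left_comp α β := funext fun i => left_comp (α i) (β i)
  right_comp α β := funext fun i => right_comp (α i) (β i)
  pcomp m n i := pcomp (m i) (n i)
  hcomp α β h i := hcomp (α i) (β i) (congrFun h i)
  left_hcomp α β h := funext fun i => left_hcomp (α i) (β i) (congrFun h i)
  right_hcomp α β h := funext fun i => right_hcomp (α i) (β i) (congrFun h i)
  hcomp_id m n := funext fun i => hcomp_id (m i) (n i)
  hcomp_comp α β γ δ h k := funext fun i =>
    hcomp_comp (α i) (β i) (γ i) (δ i) (congrFun h i) (congrFun k i)
  unit x i := unit (x i)
  unitCell f i := unitCell (f i)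
  left_unitCell f := funext fun i => left_unitCell (f i)
  right_unitCell f := funext fun i => right_unitCell (f i)
  unitCell_id x := funext fun i => unitCell_id (x i)
  unitCell_comp f g := funext fun i => unitCell_comp (f i) (g i)
  associator m n q :=
    { hom := fun i => (associator (m i) (n i) (q i)).hom
      inv := fun i => (associator (m i) (n i) (q i)).inv
      hom_inv_id := funext fun i => (associator (m i) (n i) (q i)).hom_inv_id
      inv_hom_id := funext fun i => (associator (m i) (n i) (q i)).inv_hom_id }
  left_associator m n q := funext fun i => left_associator (m i) (n i) (q i)
  right_associator m n q := funext fun i => right_associator (m i) (n i) (q i)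
  associator_naturality α β γ h k := funext fun i =>
    associator_naturality (α i) (β i) (γ i) (congrFun h i) (congrFun k i)
  leftUnitor m :=
    { hom := fun i => (leftUnitor (m i)).hom
      inv := fun i => (leftUnitor (m i)).inv
      hom_inv_id := funext fun i => (leftUnitor (m i)).hom_inv_id
      inv_hom_id := funext fun i => (leftUnitor (m i)).inv_hom_id }
  left_leftUnitor m := funext fun i => left_leftUnitor (m i)
  right_leftUnitor m := funext fun i => right_leftUnitor (m i)
  leftUnitor_naturality α := funext fun i => leftUnitor_naturality (α i)
  rightUnitor m :=
    { hom := fun i => (rightUnitor (m i)).hom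
      inv := fun i => (rightUnitor (m i)).inv
      hom_inv_id := funext fun i => (rightUnitor (m i)).hom_inv_id
      inv_hom_id := funext fun i => (rightUnitor (m i)).inv_hom_id }
  left_rightUnitor m := funext fun i => left_rightUnitor (m i)
  right_rightUnitor m := funext fun i => right_rightUnitor (m i)
  rightUnitor_naturality α := funext fun i => rightUnitor_naturality (α i)
  pentagon m n q r := funext fun i => pentagon (m i) (n i) (q i) (r i)
  triangle m n := funext fun i => triangle (m i) (n i)

end Power

/-- The diagonal double functor from `D` to `D ^ I`, constant on objects, arrows, proarrows
and cells. -/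
abbrev diagonal (D : Type u) [DoubleCategory.{c, p, v} D] (I : Type w) : LaxFunctor D (I → D) where
  obj x := fun _ => x
  map {x y} f := (fun _ => f : ∀ _ : I, x ⟶ y)
  map_id _ := rfl
  map_comp _ _ := rfl
  pro m _ := m
  cell α _ := α
  left_cell _ := rfl
  right_cell _ := rfl
  cell_id _ := rfl
  cell_comp _ _ := rfl
  laxator m n _ := 𝟙 (Proarrow.mk (pcomp m n))
  left_laxator m n := funext fun _ => left_id (Proarrow.mk (pcomp m n))
  right_laxator m n := funext fun _ => right_id (Proarrow.mk (pcomp m n))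
  laxator_naturality α β h := funext fun _ => (LaxFunctor.identity D).laxator_naturality α β h
  laxUnit x _ := 𝟙 (Proarrow.mk (unit x))
  left_laxUnit x := funext fun _ => left_id (Proarrow.mk (unit x))
  right_laxUnit x := funext fun _ => right_id (Proarrow.mk (unit x))
  laxUnit_naturality f := funext fun _ => (LaxFunctor.identity D).laxUnit_naturality f
  laxator_assoc m n q := funext fun _ => (LaxFunctor.identity D).laxator_assoc m n q
  laxator_leftUnit m := funext fun _ => (LaxFunctor.identity D).laxator_leftUnit m
  laxator_rightUnit m := funext fun _ => (LaxFunctor.identity D).laxator_rightUnit m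

/-! ### The contravariant double category of families -/

/-- Which sets are allowed as indexing sets: all (small) sets, or only finite ones. -/
inductive IndexSize where
  | small
  | finite

/-- Whether the set `I` is allowed as an indexing set. -/
def IndexSize.Admits : IndexSize → Type w → Prop
  | .small, _ => True
  | .finite, I => Finite I

/-- The apex of a span of sets `I ← A → J`, where the span is given by its fibres: `A i j` is the
set of elements `a` of the apex whose left leg is `i` and whose right leg is `j`. -/
abbrev Apex {I J : Type w} (A : I → J → Type w) : Type w := Σ i, Σ j, A i j

/-- The left leg of a span. -/
def leftLeg {I J : Type w} (A : I → J → Type w) (a : Apex A) : I := a.1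

/-- The right leg of a span. -/
def rightLeg {I J : Type w} (A : I → J → Type w) (a : Apex A) : J := a.2.1

/-- The identity span `I = I = I`. -/
inductive IdSpan (I : Type w) : I → I → Type w
  | refl (i : I) : IdSpan I i i

/-- The composite of two spans, by pullback. -/
abbrev CompSpan {I J K : Type w} (A : I → J → Type w) (B : J → K → Type w) (i : I) (k : K) :
    Type w := Σ j, A i j × B j k

theorem IndexSize.admits_punit : ∀ κ : IndexSize, κ.Admits PUnit.{w + 1}
  | .small => trivial
  | .finite => (inferInstance : Finite PUnit.{w + 1})

theorem IndexSize.admits_apex_punit :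
    ∀ κ : IndexSize, κ.Admits (Apex fun _ _ : PUnit.{w + 1} => PUnit.{w + 1})
  | .small => trivial
  | .finite => (inferInstance : Finite (Apex fun _ _ : PUnit.{w + 1} => PUnit.{w + 1}))

theorem IndexSize.admits_idSpan {I : Type w} :
    ∀ {κ : IndexSize}, κ.Admits I → κ.Admits (Apex (IdSpan I))
  | .small, _ => trivial
  | .finite, h => by
    have : Finite I := h
    exact Finite.of_surjective (fun i : I => (⟨i, i, .refl i⟩ : Apex (IdSpan I)))
      (by rintro ⟨i, _, ⟨⟩⟩; exact ⟨i, rfl⟩)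

theorem IndexSize.admits_compSpan {I J K : Type w} {A : I → J → Type w} {B : J → K → Type w} :
    ∀ {κ : IndexSize}, κ.Admits (Apex A) → κ.Admits (Apex B) → κ.Admits (Apex (CompSpan A B))
  | .small, _, _ => trivial
  | .finite, h, k => by
    have : Finite (Apex A) := h
    have : Finite (Apex B) := k
    refine Finite.of_injective (β := Apex A × Apex B)
      (fun t => (⟨t.1, t.2.2.1, t.2.2.2.1⟩, ⟨t.2.2.1, t.2.1, t.2.2.2.2⟩)) ?_
    rintro ⟨i, k, j, a, b⟩ ⟨i₁, k₁, j₁, a₁, b₁⟩ e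
    simp only [Prod.mk.injEq, Sigma.mk.injEq] at e
    obtain ⟨⟨rfl, e₁⟩, -, e₂⟩ := e
    simp only [heq_eq_eq, Sigma.mk.injEq] at e₁
    obtain ⟨rfl, e₁⟩ := e₁
    simp only [heq_eq_eq, Sigma.mk.injEq] at e₁ e₂
    obtain ⟨rfl, e₂⟩ := e₂
    simp only [heq_eq_eq] at e₁ e₂
    subst e₁ e₂
    rfl

/-- The objects of `FamOp κ D`: families of objects of `D`, indexed by a set. -/
structure FamOp (κ : IndexSize) (D : Type u) where
  Idx : Type w
  admits : κ.Admits Idx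
  obj : Idx → D

section FamOp

variable {κ : IndexSize} {D : Type u} [DoubleCategory.{c, p, v} D]

/-- An arrow of families: a function between the indexing sets in the opposite direction and
arrows `x (idx j) ⟶ y j`. -/
@[ext]
structure FamHom (X Y : FamOp.{w} κ D) where
  idx : Y.Idx → X.Idx
  map : ∀ j, X.obj (idx j) ⟶ Y.obj j

instance famCategory : Category.{max w v} (FamOp.{w} κ D) where
  Hom X Y := FamHom X Y
  id X := ⟨fun i => i, fun i => 𝟙 (X.obj i)⟩
  comp F G := ⟨fun k => F.idx (G.idx k), fun k => F.map (G.idx k) ≫ G.map k⟩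
  id_comp F := FamHom.ext rfl (heq_of_eq (funext fun j => Category.id_comp (F.map j)))
  comp_id F := FamHom.ext rfl (heq_of_eq (funext fun j => Category.comp_id (F.map j)))
  assoc _ _ _ := FamHom.ext rfl (heq_of_eq (funext fun _ => Category.assoc _ _ _))

/-- A proarrow between families: a span of sets between the indexing sets, and a family of
proarrows `m a : x i ⇸ y j` of `D`, indexed by the elements `a : i ⇸ j` of the span. -/
structure FamPro (X Y : FamOp.{w} κ D) where
  idx : X.Idx → Y.Idx → Type w
  admits : κ.Admits (Apex idx)
  pro : ∀ {i : X.Idx} {j : Y.Idx}, idx i j → Pro (X.obj i) (Y.obj j)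

instance famPro : HasPro.{max p (w + 1)} (FamOp.{w} κ D) where
  Pro X Y := FamPro X Y

/-- A cell of families: arrows of families on the left and on the right, a map of spans over their
functions between indexing sets, and a family of cells of `D` over their families of arrows. -/
structure FamCell (M N : Proarrow (FamOp.{w} κ D)) where
  left : M.src ⟶ N.src
  right : M.tgt ⟶ N.tgt
  idx : ∀ {k : N.src.Idx} {l : N.tgt.Idx}, N.pro.idx k l → M.pro.idx (left.idx k) (right.idx l)
  cell : ∀ {k : N.src.Idx} {l : N.tgt.Idx} (b : N.pro.idx k l),
    Proarrow.mk (M.pro.pro (idx b)) ⟶ Proarrow.mk (N.pro.pro b)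
  left_cell : ∀ {k : N.src.Idx} {l : N.tgt.Idx} (b : N.pro.idx k l),
    DoubleCategory.left (cell b) = left.map k
  right_cell : ∀ {k : N.src.Idx} {l : N.tgt.Idx} (b : N.pro.idx k l),
    DoubleCategory.right (cell b) = right.map l

theorem FamCell.ext {M N : Proarrow (FamOp.{w} κ D)} {α β : FamCell M N}
    (hl : α.left = β.left) (hr : α.right = β.right)
    (h : ∀ (k : N.src.Idx) (l : N.tgt.Idx) (b : N.pro.idx k l), α.idx b ≍ β.idx b)
    (h₁ : ∀ (k : N.src.Idx) (l : N.tgt.Idx) (b : N.pro.idx k l), α.cell b ≍ β.cell b) :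
    α = β := by
  obtain ⟨l, r, i, d, _, _⟩ := α
  obtain ⟨l₁, r₁, i₁, d₁, _, _⟩ := β
  dsimp only at hl hr
  subst hl hr
  have e : @i = @i₁ := by
    funext k l b
    exact eq_of_heq (h k l b)
  subst e
  have e : @d = @d₁ := by
    funext k l b
    exact eq_of_heq (h₁ k l b)
  subst e
  rfl

instance famCells : Category.{max w v c} (Proarrow (FamOp.{w} κ D)) where
  Hom M N := FamCell M N
  id M :=
    { left := 𝟙 M.src
      right := 𝟙 M.tgt
      idx := fun b => b
      cell := fun b => 𝟙 (Proarrow.mk (M.pro.pro b))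
      left_cell := fun b => left_id (Proarrow.mk (M.pro.pro b))
      right_cell := fun b => right_id (Proarrow.mk (M.pro.pro b)) }
  comp α β :=
    { left := α.left ≫ β.left
      right := α.right ≫ β.right
      idx := fun b => α.idx (β.idx b)
      cell := fun b => α.cell (β.idx b) ≫ β.cell b
      left_cell := fun b => by rw [left_comp, α.left_cell, β.left_cell]; rfl
      right_cell := fun b => by rw [right_comp, α.right_cell, β.right_cell]; rfl }
  id_comp α := FamCell.ext (Category.id_comp _) (Category.id_comp _) (fun _ _ _ => HEq.rfl)
    fun _ _ b => heq_of_eq (Category.id_comp (α.cell b))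
  comp_id α := FamCell.ext (Category.comp_id _) (Category.comp_id _) (fun _ _ _ => HEq.rfl)
    fun _ _ b => heq_of_eq (Category.comp_id (α.cell b))
  assoc α β γ := FamCell.ext (Category.assoc _ _ _) (Category.assoc _ _ _)
    (fun _ _ _ => HEq.rfl) fun _ _ _ => heq_of_eq (Category.assoc _ _ _)

/-- The external composite of two families of proarrows. -/
abbrev FamPro.comp {X Y Z : FamOp.{w} κ D} (M : FamPro X Y) (N : FamPro Y Z) : FamPro X Z where
  idx := CompSpan M.idx N.idx
  admits := IndexSize.admits_compSpan M.admits N.admits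
  pro t := pcomp (M.pro t.2.1) (N.pro t.2.2)

/-- The family of external identities on a family of objects, indexed by the identity span. -/
def IdSpan.unit {I : Type w} (x : I → D) : ∀ {i j : I}, IdSpan I i j → Pro (x i) (x j)
  | _, _, .refl i => DoubleCategory.unit (x i)

/-- The external identity on a family of objects. -/
abbrev FamPro.unit (X : FamOp.{w} κ D) : FamPro X X where
  idx := IdSpan X.Idx
  admits := IndexSize.admits_idSpan X.admits
  pro := IdSpan.unit X.obj

/-- Replace the left boundary of a family of cells by an equal arrow of families. -/
def FamCell.withLeft {M N : Proarrow (FamOp.{w} κ D)} (β : FamCell M N) (F : M.src ⟶ N.src)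
    (h : F = β.left) : FamCell M N where
  left := F
  right := β.right
  idx := by subst h; exact β.idx
  cell := by subst h; exact β.cell
  left_cell := by subst h; exact β.left_cell
  right_cell := by subst h; exact β.right_cell

/-- The external composite of two families of cells. -/
def FamCell.hcomp {X Y Z X₁ Y₁ Z₁ : FamOp.{w} κ D} {M : FamPro X Y} {N : FamPro Y Z}
    {M₁ : FamPro X₁ Y₁} {N₁ : FamPro Y₁ Z₁} (α : FamCell (.mk M) (.mk M₁))
    (β : FamCell (.mk N) (.mk N₁)) (h : α.right = β.left) :
    FamCell (.mk (M.comp N)) (.mk (M₁.comp N₁)) where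
  left := α.left
  right := β.right
  idx b := ⟨α.right.idx b.1, α.idx b.2.1, (β.withLeft α.right h).idx b.2.2⟩
  cell b := DoubleCategory.hcomp (α.cell b.2.1) ((β.withLeft α.right h).cell b.2.2)
    ((α.right_cell b.2.1).trans ((β.withLeft α.right h).left_cell b.2.2).symm)
  left_cell b := by
    exact (left_hcomp _ _ _).trans (α.left_cell b.2.1)
  right_cell b := by
    exact (right_hcomp _ _ _).trans ((β.withLeft α.right h).right_cell b.2.2)

/-- The map of identity spans induced by a function. -/
def IdSpan.map {I J : Type w} (f : J → I) : ∀ {k l : J}, IdSpan J k l → IdSpan I (f k) (f l)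
  | _, _, .refl k => .refl (f k)

/-- The family of external identity cells on a family of arrows. -/
def IdSpan.unitCell {I J : Type w} {f : J → I} {x : I → D} {y : J → D}
    (F : ∀ j, x (f j) ⟶ y j) : ∀ {k l : J} (b : IdSpan J k l),
      Proarrow.mk (IdSpan.unit x (b.map f)) ⟶ Proarrow.mk (IdSpan.unit y b)
  | _, _, .refl k => DoubleCategory.unitCell (F k)

theorem IdSpan.left_unitCell {I J : Type w} {f : J → I} {x : I → D} {y : J → D}
    (F : ∀ j, x (f j) ⟶ y j) : ∀ {k l : J} (b : IdSpan J k l), left (b.unitCell F) = F k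
  | _, _, .refl k => DoubleCategory.left_unitCell (F k)

theorem IdSpan.right_unitCell {I J : Type w} {f : J → I} {x : I → D} {y : J → D}
    (F : ∀ j, x (f j) ⟶ y j) : ∀ {k l : J} (b : IdSpan J k l), right (b.unitCell F) = F l
  | _, _, .refl k => DoubleCategory.right_unitCell (F k)

/-- The external identity cell on an arrow of families. -/
def FamCell.unit {X Y : FamOp.{w} κ D} (F : X ⟶ Y) :
    FamCell (.mk (FamPro.unit X)) (.mk (FamPro.unit Y)) where
  left := F
  right := F
  idx b := b.map F.idx
  cell b := b.unitCell F.map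
  left_cell b := b.left_unitCell F.map
  right_cell b := b.right_unitCell F.map

/-- The contravariant double category of families in `D`, indexed by sets of size `κ`. -/
instance famOp : DoubleCategory.{max w v c, max p (w + 1), max w v} (FamOp.{w} κ D) where
  toCategory := famCategory
  toHasPro := famPro
  cells := famCells
  left α := α.left
  right α := α.right
  left_id _ := rfl
  right_id _ := rfl
  left_comp _ _ := rfl
  right_comp _ _ := rfl
  pcomp M N := M.comp N
  hcomp α β h := α.hcomp β h
  left_hcomp _ _ _ := rfl
  right_hcomp _ _ _ := rfl
  hcomp_id M N := FamCell.ext rfl rfl (fun _ _ _ => HEq.rfl)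
    fun _ _ b => heq_of_eq (hcomp_id (M.pro b.2.1) (N.pro b.2.2))
  hcomp_comp α β γ δ h k := by
    obtain ⟨l, r, i, d, hl, hr⟩ := β
    obtain ⟨l₁, r₁, i₁, d₁, hl₁, hr₁⟩ := δ
    dsimp only at h k
    subst h k
    exact FamCell.ext rfl rfl (fun _ _ _ => HEq.rfl)
      fun _ _ b => heq_of_eq (hcomp_comp (α.cell _) (d _) (γ.cell _) (d₁ _) _ _)
  unit X := FamPro.unit X
  unitCell F := FamCell.unit F
  left_unitCell _ := rfl
  right_unitCell _ := rfl
  unitCell_id X := FamCell.ext rfl rfl (by rintro j _ ⟨⟩; exact HEq.rfl)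
    (by rintro j _ ⟨⟩; exact heq_of_eq (unitCell_id (X.obj j)))
  unitCell_comp F G := FamCell.ext rfl rfl (by rintro j _ ⟨⟩; exact HEq.rfl)
    (by rintro j _ ⟨⟩; exact heq_of_eq (unitCell_comp (F.map (G.idx j)) (G.map j)))
  associator M N Q :=
    { hom :=
        { left := 𝟙 _
          right := 𝟙 _
          idx := fun b => ⟨b.2.2.1, ⟨b.1, b.2.1, b.2.2.2.1⟩, b.2.2.2.2⟩
          cell := fun b => (associator (M.pro b.2.1) (N.pro b.2.2.2.1) (Q.pro b.2.2.2.2)).hom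
          left_cell := fun b => left_associator _ _ _
          right_cell := fun b => right_associator _ _ _ }
      inv :=
        { left := 𝟙 _
          right := 𝟙 _
          idx := fun b => ⟨b.2.1.1, b.2.1.2.1, ⟨b.1, b.2.1.2.2, b.2.2⟩⟩
          cell := fun b => (associator (M.pro b.2.1.2.1) (N.pro b.2.1.2.2) (Q.pro b.2.2)).inv
          left_cell := fun b => left_inv_eq_id _ (left_associator _ _ _)
          right_cell := fun b => right_inv_eq_id _ (right_associator _ _ _) }
      hom_inv_id := FamCell.ext (Category.comp_id _) (Category.comp_id _) (fun _ _ _ => HEq.rfl)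
        fun _ _ _ => heq_of_eq (Iso.hom_inv_id _)
      inv_hom_id := FamCell.ext (Category.comp_id _) (Category.comp_id _) (fun _ _ _ => HEq.rfl)
        fun _ _ _ => heq_of_eq (Iso.inv_hom_id _) }
  left_associator _ _ _ := rfl
  right_associator _ _ _ := rfl
  associator_naturality α β γ h k := by
    obtain ⟨l, r, i, d, hl, hr⟩ := β
    obtain ⟨l₁, r₁, i₁, d₁, hl₁, hr₁⟩ := γ
    dsimp only at h k
    subst h k
    exact FamCell.ext ((Category.comp_id _).trans (Category.id_comp _).symm)
      ((Category.comp_id _).trans (Category.id_comp _).symm) (fun _ _ _ => HEq.rfl)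
      fun _ _ b => heq_of_eq (associator_naturality (α.cell _) (d _) (d₁ _) _ _)
  leftUnitor M :=
    { hom :=
        { left := 𝟙 _
          right := 𝟙 _
          idx := fun {k _} b => ⟨k, .refl k, b⟩
          cell := fun b => (leftUnitor (M.pro b)).hom
          left_cell := fun b => left_leftUnitor _
          right_cell := fun b => right_leftUnitor _ }
      inv :=
        { left := 𝟙 _
          right := 𝟙 _
          idx := fun b => match b with
            | ⟨_, .refl _, b⟩ => b
          cell := fun b => match b with
            | ⟨_, .refl _, b⟩ => (leftUnitor (M.pro b)).inv
          left_cell := fun b => match b with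
            | ⟨_, .refl _, b⟩ => left_inv_eq_id _ (left_leftUnitor _)
          right_cell := fun b => match b with
            | ⟨_, .refl _, b⟩ => right_inv_eq_id _ (right_leftUnitor _) }
      hom_inv_id := FamCell.ext (Category.comp_id _) (Category.comp_id _)
        (by rintro _ _ ⟨_, ⟨_⟩, _⟩; rfl)
        (by rintro _ _ ⟨_, ⟨_⟩, _⟩; exact heq_of_eq (Iso.hom_inv_id _))
      inv_hom_id := FamCell.ext (Category.comp_id _) (Category.comp_id _) (fun _ _ _ => HEq.rfl)
        fun _ _ _ => heq_of_eq (Iso.inv_hom_id _) }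
  left_leftUnitor _ := rfl
  right_leftUnitor _ := rfl
  leftUnitor_naturality α := by
    obtain ⟨l, r, i, d, hl, hr⟩ := α
    exact FamCell.ext ((Category.comp_id _).trans (Category.id_comp _).symm)
      ((Category.comp_id _).trans (Category.id_comp _).symm) (fun _ _ _ => HEq.rfl)
      fun _ _ b => heq_of_eq (leftUnitor_naturality_of_eq (d b) (hl b))
  rightUnitor M :=
    { hom :=
        { left := 𝟙 _
          right := 𝟙 _
          idx := fun {_ l} b => ⟨l, b, .refl l⟩
          cell := fun b => (rightUnitor (M.pro b)).hom
          left_cell := fun b => left_rightUnitor _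
          right_cell := fun b => right_rightUnitor _ }
      inv :=
        { left := 𝟙 _
          right := 𝟙 _
          idx := fun b => match b with
            | ⟨_, b, .refl _⟩ => b
          cell := fun b => match b with
            | ⟨_, b, .refl _⟩ => (rightUnitor (M.pro b)).inv
          left_cell := fun b => match b with
            | ⟨_, b, .refl _⟩ => left_inv_eq_id _ (left_rightUnitor _)
          right_cell := fun b => match b with
            | ⟨_, b, .refl _⟩ => right_inv_eq_id _ (right_rightUnitor _) }
      hom_inv_id := FamCell.ext (Category.comp_id _) (Category.comp_id _)
        (by rintro _ _ ⟨_, _, ⟨_⟩⟩; rfl)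
        (by rintro _ _ ⟨_, _, ⟨_⟩⟩; exact heq_of_eq (Iso.hom_inv_id _))
      inv_hom_id := FamCell.ext (Category.comp_id _) (Category.comp_id _) (fun _ _ _ => HEq.rfl)
        fun _ _ _ => heq_of_eq (Iso.inv_hom_id _) }
  left_rightUnitor _ := rfl
  right_rightUnitor _ := rfl
  rightUnitor_naturality α := by
    obtain ⟨l, r, i, d, hl, hr⟩ := α
    exact FamCell.ext ((Category.comp_id _).trans (Category.id_comp _).symm)
      ((Category.comp_id _).trans (Category.id_comp _).symm) (fun _ _ _ => HEq.rfl)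
      fun _ _ b => heq_of_eq (rightUnitor_naturality_of_eq (d b) (hr b))
  pentagon M N Q R := FamCell.ext (Category.id_comp _) (Category.id_comp _)
    (fun _ _ _ => HEq.rfl) fun _ _ _ => heq_of_eq (pentagon _ _ _ _)
  triangle M N := FamCell.ext (Category.id_comp _) (Category.id_comp _)
    (fun _ _ _ => HEq.rfl) fun _ _ _ => heq_of_eq (triangle _ _)

/-- The singleton family on an object. -/
abbrev FamOp.singleton (κ : IndexSize) (x : D) : FamOp.{w} κ D := ⟨PUnit, κ.admits_punit, fun _ => x⟩

/-- The singleton family on a proarrow, indexed by the span `1 ← 1 → 1`. -/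
abbrev FamPro.singleton (κ : IndexSize) {x y : D} (m : Pro x y) :
    FamPro (FamOp.singleton.{w} κ x) (FamOp.singleton.{w} κ y) :=
  ⟨fun _ _ => PUnit, κ.admits_apex_punit, fun _ => m⟩

/-- The singleton family on a cell. -/
def FamCell.singleton (κ : IndexSize) {x y x₁ y₁ : D} {m : Pro x y} {n : Pro x₁ y₁}
    (α : Proarrow.mk m ⟶ Proarrow.mk n) :
    FamCell (.mk (FamPro.singleton.{w} κ m)) (.mk (FamPro.singleton.{w} κ n)) where
  left := ⟨fun i => i, fun _ => DoubleCategory.left α⟩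
  right := ⟨fun i => i, fun _ => DoubleCategory.right α⟩
  idx b := b
  cell _ := α
  left_cell _ := rfl
  right_cell _ := rfl

theorem FamCell.singleton_hcomp_cell {x y z x₁ y₁ z₁ : D} {m : Pro x y} {n : Pro y z}
    {m₁ : Pro x₁ y₁} {n₁ : Pro y₁ z₁} (α : Proarrow.mk m ⟶ Proarrow.mk m₁)
    (β : Proarrow.mk n ⟶ Proarrow.mk n₁) (h : DoubleCategory.right α = DoubleCategory.left β)
    (h₁ : (FamCell.singleton.{w} κ α).right = (FamCell.singleton.{w} κ β).left)
    (b : CompSpan (fun _ _ : PUnit.{w + 1} => PUnit.{w + 1})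
      (fun _ _ : PUnit.{w + 1} => PUnit.{w + 1}) PUnit.unit PUnit.unit) :
    ((FamCell.singleton.{w} κ α).hcomp (FamCell.singleton.{w} κ β) h₁).cell
        (k := PUnit.unit) (l := PUnit.unit) b =
      DoubleCategory.hcomp α β h := by
  have key : ∀ (F : FamOp.singleton.{w} κ y ⟶ FamOp.singleton.{w} κ y₁)
      (e : F = (FamCell.singleton.{w} κ β).left),
      ((FamCell.singleton.{w} κ β).withLeft F e).cell
        (k := PUnit.unit) (l := PUnit.unit) PUnit.unit = β := by
    rintro _ rfl
    rfl
  have e := key _ h₁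
  change DoubleCategory.hcomp α (((FamCell.singleton.{w} κ β).withLeft _ h₁).cell
        (k := PUnit.unit) (l := PUnit.unit) PUnit.unit) _ = _
  congr 1

/-- The double functor `Δ` from `D` to `FamOp κ D` that sends an object, arrow, proarrow or cell
to the family indexed by the singleton set (respectively, by the identity function or the span
`1 ← 1 → 1`). -/
abbrev singleton (κ : IndexSize) (D : Type u) [DoubleCategory.{c, p, v} D] :
    LaxFunctor D (FamOp.{w} κ D) where
  obj x := FamOp.singleton κ x
  map f := ⟨fun i => i, fun _ => f⟩
  map_id _ := rfl
  map_comp _ _ := rfl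
  pro m := FamPro.singleton κ m
  cell α := FamCell.singleton κ α
  left_cell _ := rfl
  right_cell _ := rfl
  cell_id m := FamCell.ext (FamHom.ext rfl (heq_of_eq (funext fun _ => left_id (.mk m))))
    (FamHom.ext rfl (heq_of_eq (funext fun _ => right_id (.mk m))))
    (fun _ _ _ => HEq.rfl) fun _ _ _ => HEq.rfl
  cell_comp α β := FamCell.ext (FamHom.ext rfl (heq_of_eq (funext fun _ => left_comp α β)))
    (FamHom.ext rfl (heq_of_eq (funext fun _ => right_comp α β)))
    (fun _ _ _ => HEq.rfl) fun _ _ _ => HEq.rfl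
  laxator m n :=
    { left := 𝟙 _
      right := 𝟙 _
      idx := fun _ => ⟨PUnit.unit, PUnit.unit, PUnit.unit⟩
      cell := fun _ => 𝟙 (Proarrow.mk (pcomp m n))
      left_cell := fun _ => left_id (Proarrow.mk (pcomp m n))
      right_cell := fun _ => right_id (Proarrow.mk (pcomp m n)) }
  left_laxator _ _ := rfl
  right_laxator _ _ := rfl
  laxator_naturality α β h := FamCell.ext
    (FamHom.ext rfl (heq_of_eq (funext fun _ => by
      exact (Category.comp_id _).trans ((left_hcomp α β h).symm.trans (Category.id_comp _).symm))))
    (FamHom.ext rfl (heq_of_eq (funext fun _ => by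
      exact (Category.comp_id _).trans ((right_hcomp α β h).symm.trans (Category.id_comp _).symm))))
    (fun _ _ _ => HEq.rfl)
    fun _ _ _ => heq_of_eq ((congrArg (· ≫ 𝟙 _) (FamCell.singleton_hcomp_cell α β h _ _)).trans
      ((Category.comp_id _).trans (Category.id_comp _).symm))
  laxUnit x :=
    { left := 𝟙 _
      right := 𝟙 _
      idx := fun {k _} _ => .refl k
      cell := fun _ => 𝟙 (Proarrow.mk (unit x))
      left_cell := fun _ => left_id (Proarrow.mk (unit x))
      right_cell := fun _ => right_id (Proarrow.mk (unit x)) }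
  left_laxUnit _ := rfl
  right_laxUnit _ := rfl
  laxUnit_naturality f := FamCell.ext
    (FamHom.ext rfl (heq_of_eq (funext fun _ => by
      exact (Category.comp_id _).trans ((left_unitCell f).symm.trans (Category.id_comp _).symm))))
    (FamHom.ext rfl (heq_of_eq (funext fun _ => by
      exact (Category.comp_id _).trans ((right_unitCell f).symm.trans (Category.id_comp _).symm))))
    (fun _ _ _ => HEq.rfl)
    fun _ _ _ => heq_of_eq ((LaxFunctor.identity D).laxUnit_naturality f)
  laxator_assoc m n q := FamCell.ext
    (FamHom.ext rfl (heq_of_eq (funext fun _ =>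
      congrArg (fun f => 𝟙 _ ≫ 𝟙 _ ≫ f) (left_associator m n q))))
    (FamHom.ext rfl (heq_of_eq (funext fun _ =>
      congrArg (fun f => 𝟙 _ ≫ 𝟙 _ ≫ f) (right_associator m n q))))
    (fun _ _ _ => HEq.rfl)
    fun _ _ _ => heq_of_eq ((LaxFunctor.identity D).laxator_assoc m n q)
  laxator_leftUnit m := FamCell.ext
    (FamHom.ext rfl (heq_of_eq (funext fun _ =>
      (Category.id_comp _).trans ((Category.id_comp _).trans (left_leftUnitor m)))))
    (FamHom.ext rfl (heq_of_eq (funext fun _ =>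
      (Category.id_comp _).trans ((Category.id_comp _).trans (right_leftUnitor m)))))
    (fun _ _ _ => HEq.rfl)
    fun _ _ _ => heq_of_eq ((LaxFunctor.identity D).laxator_leftUnit m)
  laxator_rightUnit m := FamCell.ext
    (FamHom.ext rfl (heq_of_eq (funext fun _ =>
      (Category.id_comp _).trans ((Category.id_comp _).trans (left_rightUnitor m)))))
    (FamHom.ext rfl (heq_of_eq (funext fun _ =>
      (Category.id_comp _).trans ((Category.id_comp _).trans (right_rightUnitor m)))))
    (fun _ _ _ => HEq.rfl)
    fun _ _ _ => heq_of_eq ((LaxFunctor.identity D).laxator_rightUnit m)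

end FamOp

/-! ### Restrictions -/

section Restrictions

variable {D : Type u} [DoubleCategory.{c, p, v} D]

/-- A restriction (cartesian) cell: every cell with the same codomain, whose left and right
boundaries factor through those of `ρ`, factors uniquely through `ρ` by a cell with the
corresponding boundaries. -/
def IsRestriction {M N : Proarrow D} (ρ : M ⟶ N) : Prop :=
  ∀ (P : Proarrow D) (h : P.src ⟶ M.src) (k : P.tgt ⟶ M.tgt) (β : P ⟶ N),
    left β = h ≫ left ρ → right β = k ≫ right ρ →
      ∃! α : P ⟶ M, left α = h ∧ right α = k ∧ α ≫ ρ = β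

/-- The proarrow `n` has a restriction along the arrows `f` and `g`. -/
def HasRestriction {x y x₁ y₁ : D} (f : x ⟶ x₁) (n : Pro x₁ y₁) (g : y ⟶ y₁) : Prop :=
  ∃ (m : Pro x y) (ρ : Proarrow.mk m ⟶ Proarrow.mk n),
    left ρ = f ∧ right ρ = g ∧ IsRestriction ρ

end Restrictions

/-! ### Products and parallel products -/

section Products

variable (κ : IndexSize) (D : Type u) [DoubleCategory.{c, p, v} D]

/-- A choice of lax products in `D`: a lax right adjoint of `Δ : D → FamOp κ D`. -/
abbrev LaxProducts := LaxRightAdjoint (singleton.{w} κ D)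

/-- `D` has lax products (for `κ = .small`), respectively lax finite products
(for `κ = .finite`). -/
def HasLaxProducts : Prop := Nonempty (LaxProducts.{w} κ D)

/-- A choice of lax parallel products in `D`: for every allowed indexing set `I`, a lax right
adjoint of the diagonal double functor `D → D ^ I`. -/
abbrev LaxParallelProducts := ∀ I : Type w, κ.Admits I → LaxRightAdjoint (diagonal D I)

variable {κ D}

/-- The products are iso-strong: the comparison cells are isomorphisms for all identities, and for
those composites of families of proarrows for which the adjacent legs of the indexing spans are
bijections. -/
def LaxProducts.IsIsoStrong (Q : LaxProducts.{w} κ D) : Prop :=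
  (∀ {X Y Z : FamOp.{w} κ D} (M : FamPro X Y) (N : FamPro Y Z),
    Function.Bijective (rightLeg M.idx) → Function.Bijective (leftLeg N.idx) →
      IsIso (Q.functor.laxator M N)) ∧
  ∀ X : FamOp.{w} κ D, IsIso (Q.functor.laxUnit X)

namespace LaxParallelProducts

/-- The parallel products are strong. -/
def IsStrong (P : LaxParallelProducts.{w} κ D) : Prop :=
  ∀ (I : Type w) (hI : κ.Admits I), (P I hI).functor.IsPseudo

/-- The product of a family of objects. -/
abbrev prod (P : LaxParallelProducts.{w} κ D) {I : Type w} (hI : κ.Admits I) (x : I → D) : D :=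
  (P I hI).functor.obj x

/-- The projections of the product of a family of objects. -/
def proj (P : LaxParallelProducts.{w} κ D) {I : Type w} (hI : κ.Admits I) (x : I → D) (i : I) :
    P.prod hI x ⟶ x i :=
  (P I hI).adj.counit.app x i

/-- The arrow into a product with given components: the adjunct of the family of components. -/
def pairing (P : LaxParallelProducts.{w} κ D) {I : Type w} (hI : κ.Admits I) {x : I → D} {y : D}
    (f : ∀ i, y ⟶ x i) : y ⟶ P.prod hI x :=
  (P I hI).adj.unit.app y ≫ (P I hI).functor.map (X := fun _ => y) (Y := x) f

/-- The parallel product of a family of proarrows. -/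
abbrev proProd (P : LaxParallelProducts.{w} κ D) {I : Type w} (hI : κ.Admits I) {x y : I → D}
    (m : ∀ i, Pro (x i) (y i)) : Pro (P.prod hI x) (P.prod hI y) :=
  (P I hI).functor.pro (x := x) (y := y) m

/-- The structure arrow between products that reindexes along a function `f`: its component at `k`
is the projection at `f k`. -/
def structureArrow (P : LaxParallelProducts.{w} κ D) {I K : Type w} (hI : κ.Admits I)
    (hK : κ.Admits K) (f : K → I) (x : I → D) :
    P.prod hI x ⟶ P.prod hK (fun k => x (f k)) :=
  P.pairing hK fun k => P.proj hI x (f k)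

/-- The parallel products have restrictions along structure arrows between products. -/
def HasStructureRestrictions (P : LaxParallelProducts.{w} κ D) : Prop :=
  ∀ {I J K : Type w} (hI : κ.Admits I) (hJ : κ.Admits J) (hK : κ.Admits K)
    (f : K → I) (g : K → J) (x : I → D) (y : J → D) (m : ∀ k, Pro (x (f k)) (y (g k))),
    HasRestriction (P.structureArrow hI hK f x) (P.proProd hK m) (P.structureArrow hJ hK g y)

end LaxParallelProducts

end Products

end Dbl

/-!
The universal property of a lax right adjoint can be checked on arrows and on cells separately: if
`F` is a pseudo double functor, then universal arrows from `F` to all objects and universal cells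
over them from `F` to all proarrows already determine a lax right adjoint, the comparison cells
being transposes of external composites of universal cells (`UniversalCells.laxRightAdjoint`). For
the diagonal and for the double functor of singleton families, universal arrows are products in
the category of objects and arrows, and universal cells are *jointly cartesian* families of cells
(`IsJointRestriction`) whose boundaries are projections. In the diagonal case both legs of the
indexing span are identities; in the case of families the span is arbitrary. A jointly cartesian
family indexed by a span with apex `K` and legs `f` and `g` is the same as a restriction of a
parallel product over `K` along the structure arrows of `f` and `g`, by composition and
cancellation for cartesian cells. This gives the equivalence between lax products and lax parallel
products with restrictions (`LaxProducts.exists_laxParallelProducts`,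
`LaxParallelProducts.HasStructureRestrictions.hasLaxProducts`).

A comparison cell has identity boundaries and is compatible with the projection cells, so it is
invertible if and only if the external composites of the projection cells (respectively, the
identity cells on the projections) are jointly cartesian. This condition does not depend on the
choice of products, so iso-strong products, applied to families over identity spans, have strong
parallel products (`LaxProducts.IsIsoStrong.isStrong`). Conversely, let the parallel products be
strong and let `M` and `N` be families whose adjacent legs are bijections. Then the product of `M`
is a restriction of a parallel product along a reindexing arrow on the left only, and the product
of `N` is one on the right only. Since identity proarrows on products are parallel products of
identities, reindexing arrows have companions and conjoints, namely products of identity proarrows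
over spans. An arrow with a companion has the property that restricting along it on the left
commutes with external composition on the right (`IsRestriction.hcomp_id`), and dually
(`IsRestriction.id_hcomp`). Hence the external composite of the two products is a restriction of a
composite of parallel products, which is itself a parallel product
(`LaxParallelProducts.IsStrong.isIsoStrong`).
-/

namespace Dbl

open HasPro DoubleCategory

/-! ### External composition of cells -/

section Cells

variable {D : Type u} [DoubleCategory.{c, p, v} D]

theorem hcomp_congr {x y z x₁ y₁ z₁ : D} {m : Pro x y} {n : Pro y z} {m₁ : Pro x₁ y₁}
    {n₁ : Pro y₁ z₁} {α α' : Proarrow.mk m ⟶ Proarrow.mk m₁}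
    {β β' : Proarrow.mk n ⟶ Proarrow.mk n₁} {h : right α = left β} (hα : α = α')
    (hβ : β = β') : hcomp α β h = hcomp α' β' (hα ▸ hβ ▸ h) := by
  subst hα hβ
  rfl

theorem isIso_right {M N : Proarrow D} (e : M ⟶ N) [IsIso e] : IsIso (right e) :=
  ⟨right (inv e), by rw [← right_comp, IsIso.hom_inv_id, right_id],
    by rw [← right_comp, IsIso.inv_hom_id, right_id]⟩

theorem left_inv_of_eq_id {x y y' : D} {m : Pro x y} {n : Pro x y'}
    (e : Proarrow.mk m ⟶ Proarrow.mk n) [IsIso e] (h : left e = 𝟙 x) : left (inv e) = 𝟙 x := by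
  have := congrArg left (IsIso.hom_inv_id e)
  rw [left_comp, h, left_id] at this
  exact (Category.id_comp _).symm.trans this

theorem right_inv_of_eq_id {x x' y : D} {m : Pro x y} {n : Pro x' y}
    (e : Proarrow.mk m ⟶ Proarrow.mk n) [IsIso e] (h : right e = 𝟙 y) : right (inv e) = 𝟙 y := by
  have := congrArg right (IsIso.hom_inv_id e)
  rw [right_comp, h, right_id] at this
  exact (Category.id_comp _).symm.trans this

theorem isIso_hcomp {x y z x₁ y₁ z₁ : D} {m : Pro x y} {n : Pro y z} {m₁ : Pro x₁ y₁}
    {n₁ : Pro y₁ z₁} (α : Proarrow.mk m ⟶ Proarrow.mk m₁) (β : Proarrow.mk n ⟶ Proarrow.mk n₁)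
    (h : right α = left β) [IsIso α] [IsIso β] : IsIso (hcomp α β h) := by
  have h' : right (inv α) = left (inv β) := by
    have := isIso_right α
    rw [← cancel_epi (right α), ← right_comp, IsIso.hom_inv_id, h, ← left_comp,
      IsIso.hom_inv_id, left_id, right_id]
  refine ⟨hcomp (inv α) (inv β) h', ?_, ?_⟩
  · rw [← hcomp_comp, ← hcomp_id]
    exact hcomp_congr (IsIso.hom_inv_id α) (IsIso.hom_inv_id β)
  · rw [← hcomp_comp, ← hcomp_id]
    exact hcomp_congr (IsIso.inv_hom_id α) (IsIso.inv_hom_id β)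

theorem isIso_unitCell {x y : D} (f : x ⟶ y) [IsIso f] : IsIso (unitCell f) :=
  ⟨unitCell (inv f), by rw [← unitCell_comp, IsIso.hom_inv_id, unitCell_id],
    by rw [← unitCell_comp, IsIso.inv_hom_id, unitCell_id]⟩

/-- Whiskering with an identity proarrow on the left is faithful on cells with identity left
boundary. -/
theorem eq_of_unit_hcomp_eq {x y y₁ : D} {m : Pro x y} {n : Pro x y₁}
    {α β : Proarrow.mk m ⟶ Proarrow.mk n} (hα : left α = 𝟙 x) (hβ : left β = 𝟙 x)
    (e : hcomp (𝟙 (Proarrow.mk (unit x))) α (by rw [right_id, hα]) =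
      hcomp (𝟙 (Proarrow.mk (unit x))) β (by rw [right_id, hβ])) : α = β := by
  rw [← cancel_epi (leftUnitor m).hom, ← leftUnitor_naturality_of_eq α hα,
    ← leftUnitor_naturality_of_eq β hβ, hcomp_congr (unitCell_id x) rfl,
    hcomp_congr (α := unitCell (𝟙 x)) (unitCell_id x) rfl, e]

theorem eq_of_hcomp_unit_eq {x x₁ y : D} {m : Pro x y} {n : Pro x₁ y}
    {α β : Proarrow.mk m ⟶ Proarrow.mk n} (hα : right α = 𝟙 y) (hβ : right β = 𝟙 y)
    (e : hcomp α (𝟙 (Proarrow.mk (unit y))) (by rw [left_id, hα]) =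
      hcomp β (𝟙 (Proarrow.mk (unit y))) (by rw [left_id, hβ])) : α = β := by
  rw [← cancel_epi (rightUnitor m).hom, ← rightUnitor_naturality_of_eq α hα,
    ← rightUnitor_naturality_of_eq β hβ, hcomp_congr rfl (unitCell_id y),
    hcomp_congr (β := unitCell (𝟙 y)) rfl (unitCell_id y), e]

theorem comp_hcomp_id {x y z x₁ x₂ : D} {m : Pro x y} (n : Pro y z) {m₁ : Pro x₁ y}
    {m₂ : Pro x₂ y} (α : Proarrow.mk m ⟶ Proarrow.mk m₁) (β : Proarrow.mk m₁ ⟶ Proarrow.mk m₂)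
    (hα : right α = 𝟙 y) (hβ : right β = 𝟙 y) :
    hcomp (α ≫ β) (𝟙 (Proarrow.mk n)) (by
      rw [right_comp, hα, hβ, left_id]; exact Category.id_comp _) =
      hcomp α (𝟙 (Proarrow.mk n)) (by rw [hα, left_id]) ≫
        hcomp β (𝟙 (Proarrow.mk n)) (by rw [hβ, left_id]) := by
  rw [← hcomp_comp]
  exact hcomp_congr rfl (Category.id_comp _).symm

theorem id_hcomp_comp {x y z z₁ z₂ : D} (m : Pro x y) {n : Pro y z} {n₁ : Pro y z₁}
    {n₂ : Pro y z₂} (α : Proarrow.mk n ⟶ Proarrow.mk n₁) (β : Proarrow.mk n₁ ⟶ Proarrow.mk n₂)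
    (hα : left α = 𝟙 y) (hβ : left β = 𝟙 y) :
    hcomp (𝟙 (Proarrow.mk m)) (α ≫ β) (by
      rw [left_comp, hα, hβ, right_id]; exact (Category.id_comp _).symm) =
      hcomp (𝟙 (Proarrow.mk m)) α (by rw [hα, right_id]) ≫
        hcomp (𝟙 (Proarrow.mk m)) β (by rw [hβ, right_id]) := by
  rw [← hcomp_comp]
  exact hcomp_congr (Category.id_comp _).symm rfl

/-- The left unitor of a composite. By Kelly's argument, this coherence condition follows from the
pentagon and triangle axioms, after whiskering with an identity proarrow. -/
theorem associator_leftUnitor {x y z : D} (m : Pro x y) (n : Pro y z) :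
    (associator (unit x) m n).hom ≫ (leftUnitor (pcomp m n)).hom =
      hcomp (leftUnitor m).hom (𝟙 (Proarrow.mk n)) (by simp) := by
  refine eq_of_unit_hcomp_eq (by simp) (by simp) ?_
  rw [id_hcomp_comp _ _ _ (by simp) (by simp)]
  have : IsIso (hcomp (associator (unit x) (unit x) m).hom (𝟙 (Proarrow.mk n))
      (by rw [right_associator, left_id])) := isIso_hcomp _ _ _
  rw [← cancel_epi (associator (unit x) (pcomp (unit x) m) n).hom,
    ← cancel_epi (hcomp (associator (unit x) (unit x) m).hom (𝟙 (Proarrow.mk n))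
      (by rw [right_associator, left_id]))]
  have h₁ := pentagon (unit x) (unit x) m n
  have h₄ := associator_naturality (rightUnitor (unit x)).hom (𝟙 (Proarrow.mk m))
    (𝟙 (Proarrow.mk n)) (by simp) (by simp)
  have h₅ := associator_naturality (𝟙 (Proarrow.mk (unit x))) (leftUnitor m).hom
    (𝟙 (Proarrow.mk n)) (by simp) (by simp)
  rw [reassoc_of% h₁, ← h₅, triangle, hcomp_congr rfl (hcomp_id m n).symm, ← h₄,
    hcomp_congr (triangle (unit x) m).symm rfl, comp_hcomp_id _ _ _ (by simp) (by simp),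
    Category.assoc]

/-- The right unitor of a composite, dual to `associator_leftUnitor`. -/
theorem associator_rightUnitor {x y z : D} (m : Pro x y) (n : Pro y z) :
    (associator m n (unit z)).hom ≫ hcomp (𝟙 (Proarrow.mk m)) (rightUnitor n).hom (by simp) =
      (rightUnitor (pcomp m n)).hom := by
  refine eq_of_hcomp_unit_eq (by simp) (by simp) ?_
  rw [comp_hcomp_id _ _ _ (by simp) (by simp), ← cancel_mono (associator m n (unit z)).hom,
    Category.assoc]
  have h₁ := pentagon m n (unit z) (unit z)
  have h₄ := associator_naturality (𝟙 (Proarrow.mk m)) (𝟙 (Proarrow.mk n))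
    (leftUnitor (unit z)).hom (by simp) (by simp)
  have h₅ := associator_naturality (𝟙 (Proarrow.mk m)) (rightUnitor n).hom
    (𝟙 (Proarrow.mk (unit z))) (by simp) (by simp)
  rw [h₅, hcomp_congr rfl (triangle n (unit z)).symm,
    id_hcomp_comp _ _ _ (by simp) (by simp), reassoc_of% h₁, ← h₄, 
    hcomp_congr (hcomp_id m n) rfl, ← triangle, Category.assoc]

end Cells

/-! ### Joint restrictions -/

section JointRestrictions

variable {D : Type u} [DoubleCategory.{c, p, v} D]

/-- A jointly cartesian family of cells with common domain: every family of cells with the same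
codomains, whose left and right boundaries factor through those of `ρ` by common arrows `h` and
`g`, factors uniquely through `ρ` by a cell with boundaries `h` and `g`. -/
def IsJointRestriction {K : Type*} {M : Proarrow D} {N : K → Proarrow D} (ρ : ∀ k, M ⟶ N k) :
    Prop :=
  ∀ (P : Proarrow D) (h : P.src ⟶ M.src) (g : P.tgt ⟶ M.tgt) (β : ∀ k, P ⟶ N k),
    (∀ k, left (β k) = h ≫ left (ρ k)) → (∀ k, right (β k) = g ≫ right (ρ k)) →
      ∃! α : P ⟶ M, left α = h ∧ right α = g ∧ ∀ k, α ≫ ρ k = β k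

namespace IsJointRestriction

variable {K : Type*} {M : Proarrow D} {N : K → Proarrow D} {ρ : ∀ k, M ⟶ N k}

theorem hom_ext (hρ : IsJointRestriction ρ) {P : Proarrow D} {α β : P ⟶ M}
    (hl : left α = left β) (hr : right α = right β) (h : ∀ k, α ≫ ρ k = β ≫ ρ k) : α = β :=
  (hρ P (left β) (right β) (fun k => β ≫ ρ k) (fun _ => left_comp _ _)
    fun _ => right_comp _ _).unique ⟨hl, hr, h⟩ ⟨rfl, rfl, fun _ => rfl⟩

/-- Restricting a jointly cartesian family gives a jointly cartesian family. -/
theorem restrict (hρ : IsJointRestriction ρ) {M' : Proarrow D} {σ : M' ⟶ M}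
    (hσ : IsRestriction σ) : IsJointRestriction fun k => σ ≫ ρ k := by
  intro P h g β hl hr
  obtain ⟨α, ⟨al, ar, e⟩, -⟩ := hρ P (h ≫ left σ) (g ≫ right σ) β
    (fun k => by rw [hl, left_comp, Category.assoc])
    (fun k => by rw [hr, right_comp, Category.assoc])
  obtain ⟨γ, ⟨cl, cr, e'⟩, hu⟩ := hσ P h g α al ar
  refine ⟨γ, ⟨cl, cr, fun k => by rw [← Category.assoc, e', e]⟩, ?_⟩
  rintro γ' ⟨cl', cr', e''⟩
  refine hu γ' ⟨cl', cr', hρ.hom_ext ?_ ?_ fun k => ?_⟩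
  · rw [left_comp, cl', al]
  · rw [right_comp, cr', ar]
  · rw [Category.assoc, e'', e]

/-- Cancellation: a comparison cell between jointly cartesian families is cartesian. -/
theorem isRestriction_of_comp (hρ : IsJointRestriction ρ) {M' : Proarrow D} {σ : M' ⟶ M}
    (hσ : IsJointRestriction fun k => σ ≫ ρ k) : IsRestriction σ := by
  intro P h g β hl hr
  obtain ⟨α, ⟨al, ar, e⟩, hu⟩ := hσ P h g (fun k => β ≫ ρ k)
    (fun k => by rw [left_comp, hl, left_comp, Category.assoc])
    (fun k => by rw [right_comp, hr, right_comp, Category.assoc])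
  refine ⟨α, ⟨al, ar, hρ.hom_ext ?_ ?_ fun k => ?_⟩, ?_⟩
  · rw [left_comp, al, hl]
  · rw [right_comp, ar, hr]
  · rw [Category.assoc, e]
  · rintro α' ⟨al', ar', rfl⟩
    exact hu α' ⟨al', ar', fun k => (Category.assoc _ _ _).symm⟩

/-- Joint cartesianness does not change if the family is reindexed along a bijection. -/
theorem reindex_iff {L : Type*} (e : L → K) (he : Function.Bijective e) :
    IsJointRestriction (fun l => ρ (e l)) ↔ IsJointRestriction ρ := by
  have ext : ∀ {P : Proarrow D} (β : ∀ l, P ⟶ N (e l)),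
      ∃ γ : ∀ k, P ⟶ N k, ∀ l, γ (e l) = β l := fun {P} β =>
    ⟨Equiv.piCongrLeft (fun k => P ⟶ N k) (Equiv.ofBijective e he) β,
      fun l => Equiv.piCongrLeft_apply_apply (fun k => P ⟶ N k) (Equiv.ofBijective e he) β l⟩
  have all : ∀ {q : K → Prop}, (∀ k, q k) ↔ ∀ l, q (e l) := he.surjective.forall
  constructor
  · intro H P h g β hl hr
    obtain ⟨α, ⟨al, ar, ha⟩, hu⟩ := H P h g (fun l => β (e l)) (fun l => hl _) fun l => hr _
    exact ⟨α, ⟨al, ar, all.2 ha⟩, fun α' h' => hu α' ⟨h'.1, h'.2.1, fun l => h'.2.2 _⟩⟩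
  · intro H P h g β hl hr
    obtain ⟨γ, hγ⟩ := ext β
    obtain ⟨α, ⟨al, ar, ha⟩, hu⟩ := H P h g γ (all.2 fun l => by rw [hγ, hl])
      (all.2 fun l => by rw [hγ, hr])
    exact ⟨α, ⟨al, ar, fun l => by rw [ha, hγ]⟩, fun α' h' =>
      hu α' ⟨h'.1, h'.2.1, all.2 fun l => by rw [h'.2.2, hγ]⟩⟩

end IsJointRestriction

theorem IsRestriction.hom_ext {M N P : Proarrow D} {ρ : M ⟶ N} (hρ : IsRestriction ρ)
    {α β : P ⟶ M} (hl : left α = left β) (hr : right α = right β) (h : α ≫ ρ = β ≫ ρ) : α = β :=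
  (hρ P (left β) (right β) (β ≫ ρ) (left_comp _ _) (right_comp _ _)).unique
    ⟨hl, hr, h⟩ ⟨rfl, rfl, rfl⟩

theorem isRestriction_of_isIso {M N : Proarrow D} (e : M ⟶ N) [IsIso e] : IsRestriction e := by
  intro P h g β hl hr
  refine ⟨β ≫ inv e, ⟨?_, ?_, by simp⟩, ?_⟩
  · rw [left_comp, hl, Category.assoc, ← left_comp, IsIso.hom_inv_id, left_id, Category.comp_id]
  · rw [right_comp, hr, Category.assoc, ← right_comp, IsIso.hom_inv_id, right_id,
      Category.comp_id]
  · rintro α ⟨-, -, rfl⟩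
    simp

theorem IsRestriction.comp {M N P : Proarrow D} {σ : M ⟶ N} {ρ : N ⟶ P} (hσ : IsRestriction σ)
    (hρ : IsRestriction ρ) : IsRestriction (σ ≫ ρ) := by
  intro Q h g β hl hr
  obtain ⟨α, ⟨al, ar, rfl⟩, -⟩ := hρ Q (h ≫ left σ) (g ≫ right σ) β
    (by rw [hl, left_comp, Category.assoc]) (by rw [hr, right_comp, Category.assoc])
  obtain ⟨γ, ⟨cl, cr, rfl⟩, hu⟩ := hσ Q h g α al ar
  refine ⟨γ, ⟨cl, cr, (Category.assoc _ _ _).symm⟩, ?_⟩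
  rintro γ' ⟨cl', cr', e⟩
  refine hu γ' ⟨cl', cr', hρ.hom_ext ?_ ?_ (by simpa using e)⟩
  · rw [left_comp, left_comp, cl, cl']
  · rw [right_comp, right_comp, cr, cr']

/-- A restriction along isomorphisms is an isomorphism. -/
theorem IsRestriction.isIso {M N : Proarrow D} {ρ : M ⟶ N} (hρ : IsRestriction ρ)
    [IsIso (left ρ)] [IsIso (right ρ)] : IsIso ρ := by
  obtain ⟨α, ⟨al, ar, e⟩, -⟩ := hρ N (inv (left ρ)) (inv (right ρ)) (𝟙 N) (by simp) (by simp)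
  refine ⟨α, hρ.hom_ext ?_ ?_ (by simp [e]), e⟩
  · rw [left_comp, al, left_id, IsIso.hom_inv_id]
  · rw [right_comp, ar, right_id, IsIso.hom_inv_id]

end JointRestrictions

/-! ### Restrictions of external composites -/

section Companions

variable {D : Type u} [DoubleCategory.{c, p, v} D]

/-- If the arrow `f` has a companion, that is, a restriction `ε` of the identity proarrow along
`f` on the left, then external composition with a proarrow on the right preserves restrictions
along `f` on the left. -/
theorem IsRestriction.hcomp_id {x y z t : D} {f : x ⟶ y} {k : Pro x y}
    {ε : Proarrow.mk k ⟶ Proarrow.mk (unit y)} (hε : IsRestriction ε) (lε : left ε = f)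
    (rε : right ε = 𝟙 y) {m' : Pro x z} {m : Pro y z} {ρ : Proarrow.mk m' ⟶ Proarrow.mk m}
    (hρ : IsRestriction ρ) (lρ : left ρ = f) (rρ : right ρ = 𝟙 z) (n : Pro z t) :
    IsRestriction (hcomp ρ (𝟙 (Proarrow.mk n)) (by rw [rρ, left_id])) := by
  -- `η` is the other structure cell of the companion, and `σ` compares the composite of `m` with
  -- the companion to the restriction `m'`
  obtain ⟨η, ⟨lη, rη, eη⟩, -⟩ := hε (.mk (unit x)) (𝟙 x) f (unitCell f)
    (by rw [left_unitCell, lε]; exact (Category.id_comp f).symm)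
    (by rw [right_unitCell, rε]; exact (Category.comp_id f).symm)
  have hεm : right ε = left (𝟙 (Proarrow.mk m)) := by rw [rε, left_id]
  obtain ⟨σ, ⟨lσ, rσ, eσ⟩, -⟩ := hρ (.mk (pcomp k m)) (𝟙 x) (𝟙 z)
    (hcomp ε (𝟙 (Proarrow.mk m)) hεm ≫ (leftUnitor m).hom)
    (by simp [lρ, lε]) (by simp [rρ])
  have hηρ : right η = left ρ := rη.trans lρ.symm
  have key : hcomp η ρ hηρ ≫ σ = (leftUnitor m').hom := by
    refine hρ.hom_ext ?_ ?_ ?_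
    · simp [lη, lσ]
    · simp [rρ, rσ]
    · rw [Category.assoc, eσ, ← Category.assoc, ← hcomp_comp, ← leftUnitor_naturality_of_eq ρ lρ]
      exact congrArg (· ≫ _) (hcomp_congr eη (Category.comp_id ρ))
  rintro ⟨q⟩ h g β hl hr
  rw [left_hcomp, lρ] at hl
  rw [right_hcomp, right_id] at hr
  have hβ : right (unitCell h ≫ η) = left β := by rw [right_comp, right_unitCell, rη, hl]
  have hσn : right σ = left (𝟙 (Proarrow.mk n)) := by rw [rσ, left_id]
  refine ⟨(leftUnitor q).inv ≫ hcomp (unitCell h ≫ η) β hβ ≫ (associator k m n).inv ≫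
    hcomp σ (𝟙 (Proarrow.mk n)) hσn, ⟨?_, ?_, ?_⟩, ?_⟩
  · simp only [left_comp, left_hcomp, left_unitCell, lη, lσ,
      left_inv_eq_id _ (left_associator k m n), left_inv_eq_id _ (left_leftUnitor q)]
    simp
  · simp only [right_comp, right_hcomp, hr, right_id,
      right_inv_eq_id _ (right_associator k m n), right_inv_eq_id _ (right_leftUnitor q)]
    simp
  · have h₁ := associator_naturality ε (𝟙 (Proarrow.mk m)) (𝟙 (Proarrow.mk n)) hεm (by simp)
    simp only [Category.assoc]
    rw [← comp_hcomp_id n σ ρ rσ rρ, hcomp_congr eσ rfl,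
      comp_hcomp_id n _ _ (by simp) (by simp), ← associator_leftUnitor, reassoc_of% h₁,
      Iso.inv_hom_id_assoc, ← Category.assoc (hcomp _ β _), ← hcomp_comp, Iso.inv_comp_eq,
      ← leftUnitor_naturality_of_eq β hl]
    refine congrArg (· ≫ _) (hcomp_congr ?_ ?_)
    · rw [Category.assoc, eη, unitCell_comp]
    · rw [DoubleCategory.hcomp_id, Category.comp_id]
  · rintro α ⟨lα, rα, rfl⟩
    have h₁ := associator_naturality η ρ (𝟙 (Proarrow.mk n)) hηρ (by rw [rρ, left_id])
    have h₂ : hcomp η (hcomp ρ (𝟙 (Proarrow.mk n)) (by rw [rρ, left_id])) (by simp [hηρ]) ≫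
        (associator k m n).inv ≫ hcomp σ (𝟙 (Proarrow.mk n)) hσn =
        (leftUnitor (pcomp m' n)).hom := by
      rw [← cancel_epi (associator (unit x) m' n).hom, ← reassoc_of% h₁, Iso.hom_inv_id_assoc,
        associator_leftUnitor, ← comp_hcomp_id n _ _ (by simp [rρ]) rσ, hcomp_congr key rfl]
    rw [hcomp_comp (unitCell h) α η _ (by simp [lα]) (by rw [left_hcomp, hηρ]), Iso.eq_inv_comp,
      ← leftUnitor_naturality_of_eq α lα, Category.assoc, h₂]

/-- The dual of `IsRestriction.hcomp_id`: a conjoint of `f` makes external composition with a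
proarrow on the left preserve restrictions along `f` on the right. -/
theorem IsRestriction.id_hcomp {x y z t : D} {f : t ⟶ z} {k : Pro z t}
    {ε : Proarrow.mk k ⟶ Proarrow.mk (unit z)} (hε : IsRestriction ε) (lε : left ε = 𝟙 z)
    (rε : right ε = f) {n' : Pro y t} {n : Pro y z} {ρ : Proarrow.mk n' ⟶ Proarrow.mk n}
    (hρ : IsRestriction ρ) (lρ : left ρ = 𝟙 y) (rρ : right ρ = f) (m : Pro x y) :
    IsRestriction (hcomp (𝟙 (Proarrow.mk m)) ρ (by rw [lρ, right_id])) := by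
  obtain ⟨η, ⟨lη, rη, eη⟩, -⟩ := hε (.mk (unit t)) f (𝟙 t) (unitCell f)
    (by rw [left_unitCell, lε]; exact (Category.comp_id f).symm)
    (by rw [right_unitCell, rε]; exact (Category.id_comp f).symm)
  have hεn : right (𝟙 (Proarrow.mk n)) = left ε := by rw [lε, right_id]
  obtain ⟨σ, ⟨lσ, rσ, eσ⟩, -⟩ := hρ (.mk (pcomp n k)) (𝟙 y) (𝟙 t)
    (hcomp (𝟙 (Proarrow.mk n)) ε hεn ≫ (rightUnitor n).hom)
    (by simp [lρ]) (by simp [rρ, rε])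
  have hηρ : right ρ = left η := rρ.trans lη.symm
  have key : hcomp ρ η hηρ ≫ σ = (rightUnitor n').hom := by
    refine hρ.hom_ext ?_ ?_ ?_
    · simp [lρ, lσ]
    · simp [rη, rσ]
    · rw [Category.assoc, eσ, ← Category.assoc, ← hcomp_comp, ← rightUnitor_naturality_of_eq ρ rρ]
      exact congrArg (· ≫ _) (hcomp_congr (Category.comp_id ρ) eη)
  rintro ⟨q⟩ h g β hl hr
  rw [left_hcomp, left_id] at hl
  rw [right_hcomp, rρ] at hr
  have hβ : right β = left (unitCell g ≫ η) := by rw [left_comp, left_unitCell, lη, hr]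
  have hσm : right (𝟙 (Proarrow.mk m)) = left σ := by rw [lσ, right_id]
  refine ⟨(rightUnitor q).inv ≫ hcomp β (unitCell g ≫ η) hβ ≫ (associator m n k).hom ≫
    hcomp (𝟙 (Proarrow.mk m)) σ hσm, ⟨?_, ?_, ?_⟩, ?_⟩
  · simp only [left_comp, left_hcomp, hl, left_id, left_associator,
      left_inv_eq_id _ (left_rightUnitor q)]
    simp
  · simp only [right_comp, right_hcomp, right_unitCell, rη, rσ, right_associator,
      right_inv_eq_id _ (right_rightUnitor q)]
    simp
  · have h₁ := associator_naturality (𝟙 (Proarrow.mk m)) (𝟙 (Proarrow.mk n)) ε (by simp) hεn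
    simp only [Category.assoc]
    rw [← id_hcomp_comp m σ ρ lσ lρ, hcomp_congr rfl eσ,
      id_hcomp_comp m _ _ (by simp) (by simp), ← reassoc_of% h₁, associator_rightUnitor,
      ← Category.assoc (hcomp β _ _), ← hcomp_comp, Iso.inv_comp_eq,
      ← rightUnitor_naturality_of_eq β hr]
    refine congrArg (· ≫ _) (hcomp_congr ?_ ?_)
    · rw [DoubleCategory.hcomp_id, Category.comp_id]
    · rw [Category.assoc, eη, unitCell_comp]
  · rintro α ⟨lα, rα, rfl⟩
    have h₁ := associator_naturality (𝟙 (Proarrow.mk m)) ρ η (by rw [lρ, right_id]) hηρ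
    have h₂ : hcomp (hcomp (𝟙 (Proarrow.mk m)) ρ (by rw [lρ, right_id])) η (by simp [hηρ]) ≫
        (associator m n k).hom ≫ hcomp (𝟙 (Proarrow.mk m)) σ hσm =
        (rightUnitor (pcomp m n')).hom := by
      rw [reassoc_of% h₁, ← associator_rightUnitor, ← id_hcomp_comp m _ _ (by simp [lρ]) lσ,
        hcomp_congr rfl key]
    rw [hcomp_comp α (unitCell g) _ η (by simp [rα]) (by rw [right_hcomp, hηρ]), Iso.eq_inv_comp,
      ← rightUnitor_naturality_of_eq α rα, Category.assoc, h₂]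

end Companions

/-! ### Lax right adjoints from universal arrows and cells -/

section Adjoints

variable {D : Type u₁} [DoubleCategory.{c₁, p₁, v₁} D] {E : Type u₂}
  [DoubleCategory.{c₂, p₂, v₂} E]

/-- Universal arrows from a lax double functor `F` to all objects, and universal cells over them
from `F` to all proarrows. The comparison cells of a right adjoint are not part of the data. -/
structure UniversalCells (F : LaxFunctor D E) where
  /-- The objects of the universal arrows. -/
  obj : E → D
  /-- The universal arrows. -/
  counit : ∀ y : E, F.obj (obj y) ⟶ y
  existsUnique_lift : ∀ {x : D} {y : E} (f : F.obj x ⟶ y),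
    ∃! g : x ⟶ obj y, F.map g ≫ counit y = f
  /-- The proarrows of the universal cells. -/
  pro : ∀ {y y' : E}, Pro y y' → Pro (obj y) (obj y')
  /-- The universal cells. -/
  counitCell : ∀ {y y' : E} (n : Pro y y'), Proarrow.mk (F.pro (pro n)) ⟶ Proarrow.mk n
  left_counitCell : ∀ {y y' : E} (n : Pro y y'), left (counitCell n) = counit y
  right_counitCell : ∀ {y y' : E} (n : Pro y y'), right (counitCell n) = counit y'
  existsUnique_liftCell : ∀ {x x' : D} {y y' : E} {m : Pro x x'} {n : Pro y y'}
    (β : Proarrow.mk (F.pro m) ⟶ Proarrow.mk n),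
    ∃! α : Proarrow.mk m ⟶ Proarrow.mk (pro n), F.cell α ≫ counitCell n = β

namespace UniversalCells

variable {F : LaxFunctor D E} (U : UniversalCells F)

/-- The transpose of an arrow. -/
noncomputable def lift {x : D} {y : E} (f : F.obj x ⟶ y) : x ⟶ U.obj y :=
  (U.existsUnique_lift f).choose

theorem map_lift {x : D} {y : E} (f : F.obj x ⟶ y) : F.map (U.lift f) ≫ U.counit y = f :=
  (U.existsUnique_lift f).choose_spec.1

theorem hom_ext {x : D} {y : E} {f g : x ⟶ U.obj y}
    (h : F.map f ≫ U.counit y = F.map g ≫ U.counit y) : f = g :=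
  (U.existsUnique_lift _).unique h rfl

/-- The transpose of a cell. -/
noncomputable def liftCell {x x' : D} {y y' : E} {m : Pro x x'} {n : Pro y y'}
    (β : Proarrow.mk (F.pro m) ⟶ Proarrow.mk n) : Proarrow.mk m ⟶ Proarrow.mk (U.pro n) :=
  (U.existsUnique_liftCell β).choose

theorem cell_liftCell {x x' : D} {y y' : E} {m : Pro x x'} {n : Pro y y'}
    (β : Proarrow.mk (F.pro m) ⟶ Proarrow.mk n) : F.cell (U.liftCell β) ≫ U.counitCell n = β :=
  (U.existsUnique_liftCell β).choose_spec.1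

theorem cell_ext {x x' : D} {y y' : E} {m : Pro x x'} {n : Pro y y'}
    {α β : Proarrow.mk m ⟶ Proarrow.mk (U.pro n)}
    (h : F.cell α ≫ U.counitCell n = F.cell β ≫ U.counitCell n) : α = β :=
  (U.existsUnique_liftCell _).unique h rfl

theorem left_liftCell {x x' : D} {y y' : E} {m : Pro x x'} {n : Pro y y'}
    (β : Proarrow.mk (F.pro m) ⟶ Proarrow.mk n) : left (U.liftCell β) = U.lift (left β) := by
  refine U.hom_ext ?_
  have h := congrArg left (U.cell_liftCell β)
  rw [left_comp, F.left_cell, U.left_counitCell] at h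
  exact h.trans (U.map_lift (left β)).symm

theorem right_liftCell {x x' : D} {y y' : E} {m : Pro x x'} {n : Pro y y'}
    (β : Proarrow.mk (F.pro m) ⟶ Proarrow.mk n) : right (U.liftCell β) = U.lift (right β) := by
  refine U.hom_ext ?_
  have h := congrArg right (U.cell_liftCell β)
  rw [right_comp, F.right_cell, U.right_counitCell] at h
  exact h.trans (U.map_lift (right β)).symm

theorem lift_counit (y : E) : U.lift (U.counit y) = 𝟙 (U.obj y) :=
  U.hom_ext (by rw [map_lift, F.map_id, Category.id_comp])

theorem lift_eq_id {y : E} {f : F.obj (U.obj y) ⟶ y} (h : f = U.counit y) :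
    U.lift f = 𝟙 (U.obj y) := h ▸ U.lift_counit y

variable (hF : F.IsPseudo)

/-- The composition comparison cells of the right adjoint: the transposes of the external
composites of the universal cells. -/
noncomputable def laxator {x y z : E} (m : Pro x y) (n : Pro y z) :
    Proarrow.mk (pcomp (U.pro m) (U.pro n)) ⟶ Proarrow.mk (U.pro (pcomp m n)) :=
  have := hF.1 (U.pro m) (U.pro n)
  U.liftCell (inv (F.laxator (U.pro m) (U.pro n)) ≫
    hcomp (U.counitCell m) (U.counitCell n) (by rw [left_counitCell, right_counitCell]))

theorem laxator_counitCell {x y z : E} (m : Pro x y) (n : Pro y z) :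
    F.laxator (U.pro m) (U.pro n) ≫ F.cell (U.laxator hF m n) ≫ U.counitCell (pcomp m n) =
      hcomp (U.counitCell m) (U.counitCell n) (by rw [left_counitCell, right_counitCell]) := by
  have := hF.1 (U.pro m) (U.pro n)
  rw [laxator, U.cell_liftCell, IsIso.hom_inv_id_assoc]

/-- The identity comparison cells of the right adjoint, as transposes of identity cells. -/
noncomputable def laxUnit (x : E) :
    Proarrow.mk (unit (U.obj x)) ⟶ Proarrow.mk (U.pro (unit x)) :=
  have := hF.2 (U.obj x)
  U.liftCell (inv (F.laxUnit (U.obj x)) ≫ unitCell (U.counit x))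

theorem laxUnit_counitCell (x : E) :
    F.laxUnit (U.obj x) ≫ F.cell (U.laxUnit hF x) ≫ U.counitCell (unit x) =
      unitCell (U.counit x) := by
  have := hF.2 (U.obj x)
  rw [laxUnit, U.cell_liftCell, IsIso.hom_inv_id_assoc]

theorem left_laxator {x y z : E} (m : Pro x y) (n : Pro y z) :
    left (U.laxator hF m n) = 𝟙 (U.obj x) := by
  have := hF.1 (U.pro m) (U.pro n)
  rw [laxator, U.left_liftCell]
  refine U.lift_eq_id ?_
  rw [left_comp, left_inv_of_eq_id _ (F.left_laxator _ _), left_hcomp, left_counitCell]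
  exact Category.id_comp _

theorem right_laxator {x y z : E} (m : Pro x y) (n : Pro y z) :
    right (U.laxator hF m n) = 𝟙 (U.obj z) := by
  have := hF.1 (U.pro m) (U.pro n)
  rw [laxator, U.right_liftCell]
  refine U.lift_eq_id ?_
  rw [right_comp, right_inv_of_eq_id _ (F.right_laxator _ _), right_hcomp, right_counitCell]
  exact Category.id_comp _

theorem left_laxUnit (x : E) : left (U.laxUnit hF x) = 𝟙 (U.obj x) := by
  have := hF.2 (U.obj x)
  rw [laxUnit, U.left_liftCell]
  refine U.lift_eq_id ?_
  rw [left_comp, left_inv_of_eq_id _ (F.left_laxUnit _), left_unitCell]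
  exact Category.id_comp _

theorem right_laxUnit (x : E) : right (U.laxUnit hF x) = 𝟙 (U.obj x) := by
  have := hF.2 (U.obj x)
  rw [laxUnit, U.right_liftCell]
  refine U.lift_eq_id ?_
  rw [right_comp, right_inv_of_eq_id _ (F.right_laxUnit _), right_unitCell]
  exact Category.id_comp _

/-- The right adjoint functor on arrows. -/
noncomputable def map {x y : E} (f : x ⟶ y) : U.obj x ⟶ U.obj y := U.lift (U.counit x ≫ f)

theorem map_counit {x y : E} (f : x ⟶ y) :
    F.map (U.map f) ≫ U.counit y = U.counit x ≫ f := U.map_lift _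

/-- The right adjoint functor on cells. -/
noncomputable def cell {x y x₁ y₁ : E} {m : Pro x y} {n : Pro x₁ y₁}
    (α : Proarrow.mk m ⟶ Proarrow.mk n) : Proarrow.mk (U.pro m) ⟶ Proarrow.mk (U.pro n) :=
  U.liftCell (U.counitCell m ≫ α)

theorem cell_counitCell {x y x₁ y₁ : E} {m : Pro x y} {n : Pro x₁ y₁}
    (α : Proarrow.mk m ⟶ Proarrow.mk n) :
    F.cell (U.cell α) ≫ U.counitCell n = U.counitCell m ≫ α := U.cell_liftCell _

theorem left_cell {x y x₁ y₁ : E} {m : Pro x y} {n : Pro x₁ y₁}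
    (α : Proarrow.mk m ⟶ Proarrow.mk n) : left (U.cell α) = U.map (left α) := by
  rw [cell, left_liftCell, left_comp, left_counitCell]; rfl

theorem right_cell {x y x₁ y₁ : E} {m : Pro x y} {n : Pro x₁ y₁}
    (α : Proarrow.mk m ⟶ Proarrow.mk n) : right (U.cell α) = U.map (right α) := by
  rw [cell, right_liftCell, right_comp, right_counitCell]; rfl

/-- Two cells out of an external composite agree if their transposes agree after precomposition
with the comparison cell of `F`. -/
theorem cell_ext_pcomp {x y z : D} {y₁ y₂ : E} {m : Pro x y} {n : Pro y z} {q : Pro y₁ y₂}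
    {α β : Proarrow.mk (pcomp m n) ⟶ Proarrow.mk (U.pro q)} (hF : F.IsPseudo)
    (h : F.laxator m n ≫ F.cell α ≫ U.counitCell q =
      F.laxator m n ≫ F.cell β ≫ U.counitCell q) : α = β :=
  have := hF.1 m n
  U.cell_ext ((cancel_epi (F.laxator m n)).1 h)

/-- The transpose of an external composite of cells followed by a comparison cell of the right
adjoint is the external composite of the transposes. -/
theorem laxator_cell_hcomp {x y z : D} {x₁ y₁ z₁ : E} {m : Pro x y} {n : Pro y z}
    {m₁ : Pro x₁ y₁} {n₁ : Pro y₁ z₁} (α : Proarrow.mk m ⟶ Proarrow.mk (U.pro m₁))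
    (β : Proarrow.mk n ⟶ Proarrow.mk (U.pro n₁)) (h : right α = left β) :
    F.laxator m n ≫ F.cell (hcomp α β h ≫ U.laxator hF m₁ n₁) ≫ U.counitCell (pcomp m₁ n₁) =
      hcomp (F.cell α ≫ U.counitCell m₁) (F.cell β ≫ U.counitCell n₁) (by
        rw [left_comp, right_comp, F.left_cell, F.right_cell, left_counitCell,
          right_counitCell, h]) := by
  rw [F.cell_comp, Category.assoc, ← Category.assoc (F.laxator m n), ← F.laxator_naturality,
    Category.assoc, laxator_counitCell, ← hcomp_comp]

/-- The lax right adjoint determined by universal arrows and cells. -/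
noncomputable def laxFunctor : LaxFunctor E D where
  obj := U.obj
  map f := U.map f
  map_id x := U.hom_ext (by rw [map_counit, F.map_id, Category.id_comp, Category.comp_id])
  map_comp f g := U.hom_ext (by
    rw [map_counit, F.map_comp, Category.assoc, map_counit, ← Category.assoc,
      ← Category.assoc, map_counit])
  pro m := U.pro m
  cell α := U.cell α
  left_cell := U.left_cell
  right_cell := U.right_cell
  cell_id m := U.cell_ext (by
    rw [cell_counitCell, F.cell_id, Category.id_comp, Category.comp_id])
  cell_comp α β := U.cell_ext (by
    rw [cell_counitCell, F.cell_comp, Category.assoc, cell_counitCell, ← Category.assoc,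
      ← Category.assoc, cell_counitCell])
  laxator := U.laxator hF
  left_laxator := U.left_laxator hF
  right_laxator := U.right_laxator hF
  laxator_naturality {x y z x₁ y₁ z₁ m n m₁ n₁} α β h := by
    refine U.cell_ext_pcomp hF ?_
    rw [laxator_cell_hcomp, F.cell_comp, Category.assoc, U.cell_counitCell (hcomp α β h),
      reassoc_of% (U.laxator_counitCell hF m n), ← hcomp_comp]
    exact hcomp_congr (U.cell_counitCell α) (U.cell_counitCell β)
  laxUnit := U.laxUnit hF
  left_laxUnit := U.left_laxUnit hF
  right_laxUnit := U.right_laxUnit hF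
  laxUnit_naturality {x y} f := by
    have := hF.2 (U.obj x)
    refine U.cell_ext ((cancel_epi (F.laxUnit (U.obj x))).1 ?_)
    rw [F.cell_comp, F.cell_comp, Category.assoc, Category.assoc, cell_counitCell,
      reassoc_of% (U.laxUnit_counitCell hF x), ← reassoc_of% (F.laxUnit_naturality (U.map f)),
      laxUnit_counitCell, ← unitCell_comp, ← unitCell_comp, map_counit]
  laxator_assoc {x y z t} m n q := by
    have := hF.1 (U.pro m) (U.pro n)
    have := isIso_hcomp (F.laxator (U.pro m) (U.pro n)) (𝟙 (Proarrow.mk (F.pro (U.pro q))))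
      (by simp)
    refine U.cell_ext_pcomp hF ((cancel_epi (hcomp (F.laxator (U.pro m) (U.pro n))
      (𝟙 (Proarrow.mk (F.pro (U.pro q)))) (by simp))).1 ?_)
    have hl := U.laxator_cell_hcomp hF (U.laxator hF m n) (𝟙 (Proarrow.mk (U.pro q)))
      (by rw [right_laxator, left_id])
    have hr := U.laxator_cell_hcomp hF (𝟙 (Proarrow.mk (U.pro m))) (U.laxator hF n q)
      (by rw [left_laxator, right_id])
    have ha := F.laxator_assoc (U.pro m) (U.pro n) (U.pro q)
    rw [← Category.assoc (hcomp _ _ _) (U.laxator hF _ _), F.cell_comp (_ ≫ _), Category.assoc,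
      cell_counitCell, reassoc_of% hl, F.cell_comp (associator (U.pro m) (U.pro n) (U.pro q)).hom,
      Category.assoc, reassoc_of% ha, hr, ← Category.assoc (hcomp (F.laxator _ _) _ _),
      ← hcomp_comp,
      hcomp_congr (U.laxator_counitCell hF m n) (by
        rw [F.cell_id, Category.id_comp, Category.id_comp]),
      associator_naturality _ _ _ (by rw [left_counitCell, right_counitCell])
        (by rw [left_counitCell, right_counitCell]), ← hcomp_comp]
    refine congrArg (_ ≫ ·) (hcomp_congr ?_ (U.laxator_counitCell hF n q).symm)
    rw [F.cell_id, Category.id_comp, Category.id_comp]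
  laxator_leftUnit {x y} m := by
    have := hF.2 (U.obj x)
    have := isIso_hcomp (F.laxUnit (U.obj x)) (𝟙 (Proarrow.mk (F.pro (U.pro m)))) (by simp)
    refine U.cell_ext_pcomp hF ((cancel_epi (hcomp (F.laxUnit (U.obj x))
      (𝟙 (Proarrow.mk (F.pro (U.pro m)))) (by simp))).1 ?_)
    have hl := U.laxator_cell_hcomp hF (U.laxUnit hF x) (𝟙 (Proarrow.mk (U.pro m)))
      (by rw [right_laxUnit, left_id])
    rw [← Category.assoc (hcomp _ _ _) (U.laxator hF _ _), F.cell_comp (_ ≫ _), Category.assoc,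
      cell_counitCell, reassoc_of% hl, reassoc_of% (F.laxator_leftUnit (U.pro m)),
      ← Category.assoc, ← hcomp_comp, hcomp_congr (U.laxUnit_counitCell hF x) (by
        rw [F.cell_id, Category.id_comp, Category.id_comp]),
      leftUnitor_naturality_of_eq _ (U.left_counitCell m)]
  laxator_rightUnit {x y} m := by
    have := hF.2 (U.obj y)
    have := isIso_hcomp (𝟙 (Proarrow.mk (F.pro (U.pro m)))) (F.laxUnit (U.obj y)) (by simp)
    refine U.cell_ext_pcomp hF ((cancel_epi (hcomp (𝟙 (Proarrow.mk (F.pro (U.pro m))))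
      (F.laxUnit (U.obj y)) (by simp))).1 ?_)
    have hr := U.laxator_cell_hcomp hF (𝟙 (Proarrow.mk (U.pro m))) (U.laxUnit hF y)
      (by rw [left_laxUnit, right_id])
    rw [← Category.assoc (hcomp _ _ _) (U.laxator hF _ _), F.cell_comp (_ ≫ _), Category.assoc,
      cell_counitCell, reassoc_of% hr, reassoc_of% (F.laxator_rightUnit (U.pro m)),
      ← Category.assoc, ← hcomp_comp, hcomp_congr (by
        rw [F.cell_id, Category.id_comp, Category.id_comp]) (U.laxUnit_counitCell hF y),
      rightUnitor_naturality_of_eq _ (U.right_counitCell m)]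

/-- A pseudo double functor with universal arrows and cells has a lax right adjoint. All coherence
conditions follow from the uniqueness of transposes. -/
noncomputable def laxRightAdjoint : LaxRightAdjoint F where
  functor := U.laxFunctor hF
  adj :=
    { unit :=
        { app := fun x => U.lift (𝟙 (F.obj x))
          naturality := fun {x y} f => U.hom_ext (by
            change F.map (f ≫ _) ≫ _ = F.map (_ ≫ U.map (F.map f)) ≫ _
            rw [F.map_comp, F.map_comp, Category.assoc, Category.assoc, map_lift, map_counit,
              reassoc_of% (U.map_lift (𝟙 (F.obj x))), Category.comp_id])
          cell := fun m => U.liftCell (𝟙 (Proarrow.mk (F.pro m)))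
          left_cell := fun m => (U.left_liftCell _).trans (congrArg U.lift (left_id _))
          right_cell := fun m => (U.right_liftCell _).trans (congrArg U.lift (right_id _))
          cell_naturality := fun {x y x₁ y₁ m n} α => U.cell_ext (by
            change F.cell (α ≫ _) ≫ _ = F.cell (_ ≫ U.cell (F.cell α)) ≫ _
            rw [F.cell_comp, F.cell_comp, Category.assoc, Category.assoc, cell_liftCell,
              cell_counitCell, reassoc_of% (U.cell_liftCell (𝟙 (Proarrow.mk (F.pro m)))),
              Category.comp_id])
          laxator_cell := fun {x y z} m n => U.cell_ext_pcomp hF (by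
            have hmn : right (U.liftCell (𝟙 (Proarrow.mk (F.pro m)))) =
                left (U.liftCell (𝟙 (Proarrow.mk (F.pro n)))) := by
              rw [left_liftCell, right_liftCell, left_id, right_id]
            have h := U.laxator_cell_hcomp hF _ _ hmn
            change F.laxator m n ≫ F.cell (𝟙 _ ≫ U.liftCell (𝟙 _)) ≫ U.counitCell _ =
              F.laxator m n ≫ F.cell (hcomp (U.liftCell (𝟙 (Proarrow.mk (F.pro m))))
                (U.liftCell (𝟙 (Proarrow.mk (F.pro n)))) hmn ≫ U.laxator hF _ _ ≫
                U.cell (F.laxator m n)) ≫ U.counitCell _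
            rw [Category.id_comp, cell_liftCell, Category.comp_id, ← Category.assoc (hcomp _ _ _),
              F.cell_comp (_ ≫ _), Category.assoc, cell_counitCell, reassoc_of% h,
              hcomp_congr (U.cell_liftCell _) (U.cell_liftCell _), hcomp_id, Category.id_comp])
          laxUnit_cell := fun x => by
            have := hF.2 x
            refine U.cell_ext ((cancel_epi (F.laxUnit x)).1 ?_)
            change F.laxUnit x ≫ F.cell (𝟙 _ ≫ _) ≫ _ =
              F.laxUnit x ≫ F.cell (unitCell _ ≫ U.laxUnit hF _ ≫ U.cell (F.laxUnit x)) ≫ _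
            rw [Category.id_comp, cell_liftCell, Category.comp_id, F.cell_comp, F.cell_comp,
              Category.assoc, Category.assoc, cell_counitCell, ← reassoc_of% (F.laxUnit_naturality
              (U.lift (𝟙 (F.obj x)))), reassoc_of% (U.laxUnit_counitCell hF (F.obj x)),
              ← Category.assoc, ← unitCell_comp, map_lift, unitCell_id, Category.id_comp] }
      counit :=
        { app := U.counit
          naturality := fun f => U.map_counit f
          cell := fun m => U.counitCell m
          left_cell := U.left_counitCell
          right_cell := U.right_counitCell
          cell_naturality := fun α => U.cell_counitCell α
          laxator_cell := fun m n => by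
            change (F.laxator _ _ ≫ F.cell (U.laxator hF m n)) ≫ _ = _ ≫ 𝟙 _
            rw [Category.assoc]
            exact (U.laxator_counitCell hF m n).trans (Category.comp_id _).symm
          laxUnit_cell := fun x => by
            change (F.laxUnit _ ≫ F.cell (U.laxUnit hF x)) ≫ _ = _ ≫ 𝟙 _
            rw [Category.assoc]
            exact (U.laxUnit_counitCell hF x).trans (Category.comp_id _).symm }
      left_triangle := fun x => U.map_lift _
      left_triangle_cell := fun m => U.cell_liftCell _
      right_triangle := fun y => U.hom_ext (by
        change F.map (U.lift (𝟙 (F.obj (U.obj y))) ≫ U.map (U.counit y)) ≫ U.counit y =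
          F.map (𝟙 (U.obj y)) ≫ U.counit y
        rw [F.map_comp, Category.assoc, map_counit, reassoc_of% (U.map_lift (𝟙 (F.obj (U.obj y)))),
          F.map_id, Category.id_comp])
      right_triangle_cell := fun {x y} n => U.cell_ext (by
        change F.cell (U.liftCell (𝟙 (Proarrow.mk (F.pro (U.pro n)))) ≫ U.cell (U.counitCell n)) ≫
          U.counitCell n = F.cell (𝟙 (Proarrow.mk (U.pro n))) ≫ U.counitCell n
        rw [F.cell_comp, Category.assoc, cell_counitCell,
          reassoc_of% (U.cell_liftCell (𝟙 (Proarrow.mk (F.pro (U.pro n))))),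
          F.cell_id, Category.id_comp]) }

end UniversalCells

namespace LaxRightAdjoint

variable {F : LaxFunctor D E} (R : LaxRightAdjoint F)

theorem existsUnique_lift {x : D} {y : E} (f : F.obj x ⟶ y) :
    ∃! g : x ⟶ R.functor.obj y, F.map g ≫ R.adj.counit.app y = f := by
  refine ⟨R.adj.unit.app x ≫ R.functor.map f, ?_, ?_⟩
  · have h : F.map (R.functor.map f) ≫ R.adj.counit.app y = R.adj.counit.app _ ≫ f :=
      R.adj.counit.naturality f
    change F.map _ ≫ _ = f
    rw [F.map_comp, Category.assoc, h, reassoc_of% (R.adj.left_triangle x)]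
  · rintro g rfl
    have h : g ≫ R.adj.unit.app _ = R.adj.unit.app x ≫ R.functor.map (F.map g) :=
      R.adj.unit.naturality g
    rw [R.functor.map_comp, ← reassoc_of% h, R.adj.right_triangle, Category.comp_id]

theorem existsUnique_liftCell {x x' : D} {y y' : E} {m : Pro x x'} {n : Pro y y'}
    (β : Proarrow.mk (F.pro m) ⟶ Proarrow.mk n) :
    ∃! α : Proarrow.mk m ⟶ Proarrow.mk (R.functor.pro n),
      F.cell α ≫ R.adj.counit.cell n = β := by
  refine ⟨R.adj.unit.cell m ≫ R.functor.cell β, ?_, ?_⟩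
  · have h : F.cell (R.functor.cell β) ≫ R.adj.counit.cell n = R.adj.counit.cell _ ≫ β :=
      R.adj.counit.cell_naturality β
    change F.cell _ ≫ _ = β
    rw [F.cell_comp, Category.assoc, h, reassoc_of% (R.adj.left_triangle_cell m)]
  · rintro α rfl
    have h : α ≫ R.adj.unit.cell _ = R.adj.unit.cell m ≫ R.functor.cell (F.cell α) :=
      R.adj.unit.cell_naturality α
    rw [R.functor.cell_comp, ← reassoc_of% h, R.adj.right_triangle_cell, Category.comp_id]

/-- The counit sends a comparison cell of the right adjoint to the external composite of its
components. -/
theorem laxator_counit {x y z : E} (m : Pro x y) (n : Pro y z) :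
    F.laxator (R.functor.pro m) (R.functor.pro n) ≫ F.cell (R.functor.laxator m n) ≫
        R.adj.counit.cell (pcomp m n) =
      hcomp (R.adj.counit.cell m) (R.adj.counit.cell n) (by
        rw [R.adj.counit.left_cell, R.adj.counit.right_cell]) := by
  rw [← Category.assoc]
  exact (R.adj.counit.laxator_cell m n).trans (Category.comp_id _)

theorem laxUnit_counit (x : E) :
    F.laxUnit (R.functor.obj x) ≫ F.cell (R.functor.laxUnit x) ≫ R.adj.counit.cell (unit x) =
      unitCell (R.adj.counit.app x) := by
  rw [← Category.assoc]
  exact (R.adj.counit.laxUnit_cell x).trans (Category.comp_id _)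

end LaxRightAdjoint
end Adjoints

/-! ### Product cones and joint restrictions over them -/

section ProductCones

variable {D : Type u} [DoubleCategory.{c, p, v} D]

/-- The family of arrows `π` exhibits `q` as the product of the objects `x i` in the category of
objects and arrows. -/
def IsProductCone {I : Type*} {q : D} {x : I → D} (π : ∀ i, q ⟶ x i) : Prop :=
  ∀ (y : D) (f : ∀ i, y ⟶ x i), ∃! g : y ⟶ q, ∀ i, g ≫ π i = f i

namespace IsProductCone

variable {I : Type*} {q : D} {x : I → D} {π : ∀ i, q ⟶ x i}

theorem hom_ext (hπ : IsProductCone π) {y : D} {f g : y ⟶ q} (h : ∀ i, f ≫ π i = g ≫ π i) :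
    f = g :=
  (hπ y _).unique h fun _ => rfl

theorem exists_isIso (hπ : IsProductCone π) {q' : D} {π' : ∀ i, q' ⟶ x i}
    (hπ' : IsProductCone π') : ∃ h : q ⟶ q', IsIso h ∧ ∀ i, h ≫ π' i = π i := by
  obtain ⟨h, hh, -⟩ := hπ' q π
  obtain ⟨k, hk, -⟩ := hπ q' π'
  exact ⟨h, ⟨k, hπ.hom_ext fun i => by rw [Category.assoc, hk, hh, Category.id_comp],
    hπ'.hom_ext fun i => by rw [Category.assoc, hh, hk, Category.id_comp]⟩, hh⟩

end IsProductCone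

namespace IsJointRestriction

/-- A family of cells over two product cones, indexed by a span of sets with legs `f` and `g`, is
jointly cartesian if and only if families of cells, together with extensions of their boundaries to
families of arrows over all indices, factor uniquely through it. -/
theorem iff_of_isProductCone {I J K : Type*} {q r : D} {x : I → D} {y : J → D}
    {π : ∀ i, q ⟶ x i} {τ : ∀ j, r ⟶ y j} (hπ : IsProductCone π) (hτ : IsProductCone τ)
    {f : K → I} {g : K → J} {n : ∀ k, Pro (x (f k)) (y (g k))} {m : Pro q r}
    {ρ : ∀ k, Proarrow.mk m ⟶ Proarrow.mk (n k)} (hl : ∀ k, left (ρ k) = π (f k))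
    (hr : ∀ k, right (ρ k) = τ (g k)) :
    IsJointRestriction ρ ↔ ∀ (P : Proarrow D) (s : ∀ i, P.src ⟶ x i) (t : ∀ j, P.tgt ⟶ y j)
      (β : ∀ k, P ⟶ Proarrow.mk (n k)), (∀ k, left (β k) = s (f k)) →
      (∀ k, right (β k) = t (g k)) → ∃! α : P ⟶ Proarrow.mk m,
        (∀ i, left α ≫ π i = s i) ∧ (∀ j, right α ≫ τ j = t j) ∧ ∀ k, α ≫ ρ k = β k := by
  constructor
  · intro H P s t β hs ht
    obtain ⟨h, hh, -⟩ := hπ P.src s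
    obtain ⟨k, hk, -⟩ := hτ P.tgt t
    obtain ⟨α, ⟨rfl, rfl, e⟩, hu⟩ := H P h k β (fun i => by rw [hs, hl, hh])
      fun i => by rw [ht, hr, hk]
    refine ⟨α, ⟨hh, hk, e⟩, ?_⟩
    rintro α' ⟨hh', hk', e'⟩
    exact hu α' ⟨hπ.hom_ext fun i => (hh' i).trans (hh i).symm,
      hτ.hom_ext fun i => (hk' i).trans (hk i).symm, e'⟩
  · intro H P h k β hs ht
    obtain ⟨α, ⟨al, ar, e⟩, hu⟩ := H P (fun i => h ≫ π i) (fun j => k ≫ τ j) β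
      (fun i => by rw [hs, hl]) fun i => by rw [ht, hr]
    refine ⟨α, ⟨hπ.hom_ext al, hτ.hom_ext ar, e⟩, ?_⟩
    rintro α' ⟨rfl, rfl, e'⟩
    exact hu α' ⟨fun _ => rfl, fun _ => rfl, e'⟩

/-- A jointly cartesian family whose boundaries factor through those of another one is a
restriction of it. -/
theorem exists_isRestriction {K : Type*} {M M' : Proarrow D} {N : K → Proarrow D}
    {ρ : ∀ k, M ⟶ N k} {ρ' : ∀ k, M' ⟶ N k} (hρ : IsJointRestriction ρ)
    (hρ' : IsJointRestriction ρ') (h : M'.src ⟶ M.src) (g : M'.tgt ⟶ M.tgt)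
    (hl : ∀ k, left (ρ' k) = h ≫ left (ρ k)) (hr : ∀ k, right (ρ' k) = g ≫ right (ρ k)) :
    ∃ σ : M' ⟶ M, left σ = h ∧ right σ = g ∧ (∀ k, σ ≫ ρ k = ρ' k) ∧ IsRestriction σ := by
  obtain ⟨σ, ⟨sl, sr, e⟩, -⟩ := hρ M' h g ρ' hl hr
  refine ⟨σ, sl, sr, e, hρ.isRestriction_of_comp ?_⟩
  rwa [funext e]

theorem isIso_iff {K : Type*} {x y : D} {m m' : Pro x y} {N : K → Proarrow D}
    {ρ : ∀ k, Proarrow.mk m ⟶ N k} (hρ : IsJointRestriction ρ)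
    {σ : Proarrow.mk m' ⟶ Proarrow.mk m} (hl : left σ = 𝟙 x) (hr : right σ = 𝟙 y) :
    IsIso σ ↔ IsJointRestriction fun k => σ ≫ ρ k := by
  constructor
  · intro _
    exact hρ.restrict (isRestriction_of_isIso σ)
  · intro h
    have : IsIso (left σ) := by rw [hl]; exact inferInstanceAs (IsIso (𝟙 x))
    have : IsIso (right σ) := by rw [hr]; exact inferInstanceAs (IsIso (𝟙 y))
    exact (hρ.isRestriction_of_comp h).isIso

section Transport

variable {I : Type*} {x y z : I → D} {q q' : D} {π : ∀ i, q ⟶ x i} {π' : ∀ i, q' ⟶ x i}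
  {r r' : D} {τ : ∀ i, r ⟶ y i} {τ' : ∀ i, r' ⟶ y i}
  {s s' : D} {υ : ∀ i, s ⟶ z i} {υ' : ∀ i, s' ⟶ z i}

/-- Parallel products of proarrows over two choices of products are canonically isomorphic. -/
theorem exists_isIso (hπ : IsProductCone π) (hπ' : IsProductCone π') (hτ : IsProductCone τ)
    (hτ' : IsProductCone τ') {n : ∀ i, Pro (x i) (y i)} {m : Pro q r} {m' : Pro q' r'}
    {ρ : ∀ i, Proarrow.mk m ⟶ Proarrow.mk (n i)} {ρ' : ∀ i, Proarrow.mk m' ⟶ Proarrow.mk (n i)}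
    (hρ : IsJointRestriction ρ) (hρ' : IsJointRestriction ρ') (hl : ∀ i, left (ρ i) = π i)
    (hr : ∀ i, right (ρ i) = τ i) (hl' : ∀ i, left (ρ' i) = π' i)
    (hr' : ∀ i, right (ρ' i) = τ' i) :
    ∃ e : Proarrow.mk m ⟶ Proarrow.mk m', IsIso e ∧ ∀ i, e ≫ ρ' i = ρ i := by
  obtain ⟨h, _, hh⟩ := hπ.exists_isIso hπ'
  obtain ⟨k, _, hk⟩ := hτ.exists_isIso hτ'
  obtain ⟨e, rfl, rfl, he, hR⟩ := hρ'.exists_isRestriction hρ h k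
    (fun i => by rw [hl, hl', hh]) fun i => by rw [hr, hr', hk]
  exact ⟨e, hR.isIso, he⟩

/-- Whether external composites of parallel products are parallel products does not depend on the
choice of products. -/
theorem hcomp_of_hcomp (hπ : IsProductCone π) (hπ' : IsProductCone π') (hτ : IsProductCone τ)
    (hτ' : IsProductCone τ') (hυ : IsProductCone υ) (hυ' : IsProductCone υ')
    {a : ∀ i, Pro (x i) (y i)} {b : ∀ i, Pro (y i) (z i)} {m : Pro q r} {m' : Pro q' r'}
    {n : Pro r s} {n' : Pro r' s'}
    {ρ : ∀ i, Proarrow.mk m ⟶ Proarrow.mk (a i)} {ρ' : ∀ i, Proarrow.mk m' ⟶ Proarrow.mk (a i)}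
    {σ : ∀ i, Proarrow.mk n ⟶ Proarrow.mk (b i)} {σ' : ∀ i, Proarrow.mk n' ⟶ Proarrow.mk (b i)}
    (hρ : IsJointRestriction ρ) (hρ' : IsJointRestriction ρ') (hσ : IsJointRestriction σ)
    (hσ' : IsJointRestriction σ') (lρ : ∀ i, left (ρ i) = π i) (rρ : ∀ i, right (ρ i) = τ i)
    (lρ' : ∀ i, left (ρ' i) = π' i) (rρ' : ∀ i, right (ρ' i) = τ' i)
    (lσ : ∀ i, left (σ i) = τ i) (rσ : ∀ i, right (σ i) = υ i)
    (lσ' : ∀ i, left (σ' i) = τ' i) (rσ' : ∀ i, right (σ' i) = υ' i)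
    (H : IsJointRestriction fun i => hcomp (ρ' i) (σ' i) (by rw [rρ', lσ'])) :
    IsJointRestriction fun i => hcomp (ρ i) (σ i) (by rw [rρ, lσ]) := by
  obtain ⟨d, _, hd⟩ := exists_isIso hπ hπ' hτ hτ' hρ hρ' lρ rρ lρ' rρ'
  obtain ⟨e, _, he⟩ := exists_isIso hτ hτ' hυ hυ' hσ hσ' lσ rσ lσ' rσ'
  have hde : right d = left e := hτ'.hom_ext fun i => by
    have h₁ := congrArg right (hd i)
    have h₂ := congrArg left (he i)
    rw [right_comp, rρ', rρ] at h₁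
    rw [left_comp, lσ', lσ] at h₂
    exact h₁.trans h₂.symm
  have := isIso_hcomp d e hde
  convert H.restrict (isRestriction_of_isIso (hcomp d e hde)) using 2 with i
  rw [← hcomp_comp]
  exact hcomp_congr (hd i).symm (he i).symm

/-- Whether identity proarrows on products are parallel products of identity proarrows does not
depend on the choice of products. -/
theorem unitCell_of_unitCell (hπ : IsProductCone π) (hπ' : IsProductCone π')
    (H : IsJointRestriction fun i => unitCell (π' i)) :
    IsJointRestriction fun i => unitCell (π i) := by
  obtain ⟨h, _, hh⟩ := hπ.exists_isIso hπ'
  have := isIso_unitCell h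
  convert H.restrict (isRestriction_of_isIso (unitCell h)) using 2 with i
  rw [← unitCell_comp, hh]

end Transport

end IsJointRestriction

end ProductCones

/-! ### Parallel products -/

section Parallel

variable {κ : IndexSize} {D : Type u} [DoubleCategory.{c, p, v} D]

theorem isPseudo_diagonal (I : Type w) : (diagonal D I).IsPseudo :=
  ⟨fun {x _ z} m n => inferInstanceAs (IsIso (𝟙 (Proarrow.mk (D := I → D) (src := fun _ => x)
      (tgt := fun _ => z) fun _ => pcomp m n))),
    fun x => inferInstanceAs (IsIso (𝟙 (Proarrow.mk (D := I → D) (src := fun _ => x)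
      (tgt := fun _ => x) fun _ => unit x)))⟩

/-- Products of objects and parallel products of proarrows, given by jointly cartesian families,
are universal arrows and cells from the diagonal double functor. -/
def diagonalUniversalCells {I : Type w} (obj : (I → D) → D) (π : ∀ x i, obj x ⟶ x i)
    (hπ : ∀ x, IsProductCone (π x)) (pro : ∀ {x y : I → D}, Pro x y → Pro (obj x) (obj y))
    (ρ : ∀ {x y : I → D} (n : Pro x y) (i : I), Proarrow.mk (pro n) ⟶ Proarrow.mk (n i))
    (hl : ∀ {x y : I → D} (n : Pro x y) (i : I), left (ρ n i) = π x i)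
    (hr : ∀ {x y : I → D} (n : Pro x y) (i : I), right (ρ n i) = π y i)
    (hρ : ∀ {x y : I → D} (n : Pro x y), IsJointRestriction (ρ n)) :
    UniversalCells (diagonal D I) where
  obj := obj
  counit x := π x
  existsUnique_lift f := by
    obtain ⟨g, hg, hu⟩ := hπ _ _ f
    exact ⟨g, funext hg, fun g' hg' => hu g' (congrFun hg')⟩
  pro := pro
  counitCell n := ρ n
  left_counitCell n := funext (hl n)
  right_counitCell n := funext (hr n)
  existsUnique_liftCell {x x' y y' m n} β := by
    obtain ⟨α, ⟨-, -, e⟩, hu⟩ := (IsJointRestriction.iff_of_isProductCone (f := id) (g := id)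
      (hπ y) (hπ y') (hl n) (hr n)).1 (hρ n) (.mk m) (fun i => left (β i)) (fun i => right (β i)) β
      (fun _ => rfl) fun _ => rfl
    refine ⟨α, funext e, fun α' e' => hu α' ⟨fun i => ?_, fun i => ?_, congrFun e'⟩⟩
    · have := congrArg left (congrFun e' i)
      exact (congrArg (_ ≫ ·) (hl n i)).symm.trans ((left_comp _ _).symm.trans this)
    · have := congrArg right (congrFun e' i)
      exact (congrArg (_ ≫ ·) (hr n i)).symm.trans ((right_comp _ _).symm.trans this)

namespace LaxParallelProducts

variable (P : LaxParallelProducts.{w} κ D) {I : Type w} (hI : κ.Admits I)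

theorem isProductCone_proj (x : I → D) : IsProductCone (P.proj hI x) := by
  intro y f
  obtain ⟨g, hg, hu⟩ := (P I hI).existsUnique_lift (x := y) (y := x) f
  exact ⟨g, congrFun hg, fun g' hg' => hu g' (funext hg')⟩

theorem pairing_proj {x : I → D} {y : D} (f : ∀ i, y ⟶ x i) (i : I) :
    P.pairing hI f ≫ P.proj hI x i = f i := by
  have h₁ := congrFun ((P I hI).adj.counit.naturality (x := fun _ => y) (y := x) f) i
  have h₂ := congrFun ((P I hI).adj.left_triangle y) i
  change (P I hI).functor.map (X := fun _ => y) (Y := x) f ≫ P.proj hI x i =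
    (P I hI).adj.counit.app (fun _ => y) i ≫ f i at h₁
  change (P I hI).adj.unit.app y ≫ (P I hI).adj.counit.app (fun _ => y) i = 𝟙 y at h₂
  change ((P I hI).adj.unit.app y ≫ _) ≫ _ = _
  refine (Category.assoc _ _ _).trans ((congrArg (_ ≫ ·) h₁).trans ?_)
  refine (Category.assoc _ _ _).symm.trans ((congrArg (· ≫ f i) h₂).trans (Category.id_comp _))

/-- The projection cells of the parallel product of a family of proarrows. -/
def proCell {x y : I → D} (m : ∀ i, Pro (x i) (y i)) (i : I) :
    Proarrow.mk (P.proProd hI m) ⟶ Proarrow.mk (m i) :=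
  (P I hI).adj.counit.cell (x := x) (y := y) m i

theorem left_proCell {x y : I → D} (m : ∀ i, Pro (x i) (y i)) (i : I) :
    left (P.proCell hI m i) = P.proj hI x i :=
  congrFun ((P I hI).adj.counit.left_cell (x := x) (y := y) m) i

theorem right_proCell {x y : I → D} (m : ∀ i, Pro (x i) (y i)) (i : I) :
    right (P.proCell hI m i) = P.proj hI y i :=
  congrFun ((P I hI).adj.counit.right_cell (x := x) (y := y) m) i

theorem isJointRestriction_proCell {x y : I → D} (m : ∀ i, Pro (x i) (y i)) :
    IsJointRestriction (P.proCell hI m) := by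
  refine (IsJointRestriction.iff_of_isProductCone (f := id) (g := id) (P.isProductCone_proj hI x)
    (P.isProductCone_proj hI y) (P.left_proCell hI m) (P.right_proCell hI m)).2 ?_
  rintro ⟨q⟩ s t β hs ht
  obtain ⟨α, hα, hu⟩ := (P I hI).existsUnique_liftCell (m := q) (n := m) β
  have hα : ∀ i, α ≫ P.proCell hI m i = β i := congrFun hα
  refine ⟨α, ⟨fun i => ?_, fun i => ?_, hα⟩, fun α' h => hu α' (funext h.2.2)⟩
  · rw [← P.left_proCell hI m i, ← left_comp, hα, hs]; rfl
  · rw [← P.right_proCell hI m i, ← right_comp, hα, ht]; rfl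

/-- The composition comparison cell of parallel products is invertible exactly when the external
composite of the parallel products is a parallel product. -/
theorem isIso_laxator_iff {x y z : I → D} (m : ∀ i, Pro (x i) (y i)) (n : ∀ i, Pro (y i) (z i)) :
    IsIso ((P I hI).functor.laxator (x := x) (y := y) (z := z) m n) ↔
      IsJointRestriction fun i => hcomp (P.proCell hI m i) (P.proCell hI n i) (by
        rw [left_proCell, right_proCell]) := by
  rw [(P.isJointRestriction_proCell hI fun i => pcomp (m i) (n i)).isIso_iff
    ((P I hI).functor.left_laxator (x := x) (y := y) (z := z) m n)
    ((P I hI).functor.right_laxator (x := x) (y := y) (z := z) m n)]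
  have h : ∀ i, (P I hI).functor.laxator (x := x) (y := y) (z := z) m n ≫
      P.proCell hI (fun i => pcomp (m i) (n i)) i =
      hcomp (P.proCell hI m i) (P.proCell hI n i) (by rw [left_proCell, right_proCell]) :=
    fun i => (Category.id_comp _).symm.trans
      (congrFun ((P I hI).laxator_counit (x := x) (y := y) (z := z) m n) i)
  rw [funext h]

theorem isIso_laxUnit_iff (x : I → D) :
    IsIso ((P I hI).functor.laxUnit x) ↔
      IsJointRestriction fun i => unitCell (P.proj hI x i) := by
  rw [(P.isJointRestriction_proCell hI fun i => unit (x i)).isIso_iff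
    ((P I hI).functor.left_laxUnit x) ((P I hI).functor.right_laxUnit x)]
  have h : ∀ i, (P I hI).functor.laxUnit x ≫ P.proCell hI (fun i => unit (x i)) i =
      unitCell (P.proj hI x i) :=
    fun i => (Category.id_comp _).symm.trans (congrFun ((P I hI).laxUnit_counit x) i)
  rw [funext h]

theorem structureArrow_proj {K : Type w} (hK : κ.Admits K) (f : K → I) (x : I → D) (k : K) :
    P.structureArrow hI hK f x ≫ P.proj hK (fun k => x (f k)) k = P.proj hI x (f k) :=
  P.pairing_proj hK _ k

/-- A jointly cartesian family whose boundaries are projections is a restriction of a parallel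
product along structure arrows. -/
theorem hasRestriction_of_isJointRestriction {J K : Type w} (hJ : κ.Admits J) (hK : κ.Admits K)
    {f : K → I} {g : K → J} {x : I → D} {y : J → D} {n : ∀ k, Pro (x (f k)) (y (g k))}
    {m : Pro (P.prod hI x) (P.prod hJ y)} {ρ : ∀ k, Proarrow.mk m ⟶ Proarrow.mk (n k)}
    (hρ : IsJointRestriction ρ) (hl : ∀ k, left (ρ k) = P.proj hI x (f k))
    (hr : ∀ k, right (ρ k) = P.proj hJ y (g k)) :
    HasRestriction (P.structureArrow hI hK f x) (P.proProd hK n) (P.structureArrow hJ hK g y) := by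
  obtain ⟨σ, sl, sr, -, hσ⟩ := (P.isJointRestriction_proCell hK n).exists_isRestriction hρ
    (P.structureArrow hI hK f x) (P.structureArrow hJ hK g y)
    (fun k => by
      rw [hl, left_proCell]; exact (P.structureArrow_proj hI hK f x k).symm)
    (fun k => by
      rw [hr, right_proCell]; exact (P.structureArrow_proj hJ hK g y k).symm)
  exact ⟨m, σ, sl, sr, hσ⟩

/-- Restrictions along structure arrows give jointly cartesian families over projections, indexed
by arbitrary spans. -/
theorem HasStructureRestrictions.exists_isJointRestriction {P : LaxParallelProducts.{w} κ D}
    (hP : P.HasStructureRestrictions) {I J K : Type w} (hI : κ.Admits I) (hJ : κ.Admits J)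
    (hK : κ.Admits K) (f : K → I) (g : K → J) (x : I → D) (y : J → D)
    (n : ∀ k, Pro (x (f k)) (y (g k))) :
    ∃ (m : Pro (P.prod hI x) (P.prod hJ y)) (ρ : ∀ k, Proarrow.mk m ⟶ Proarrow.mk (n k)),
      (∀ k, left (ρ k) = P.proj hI x (f k)) ∧ (∀ k, right (ρ k) = P.proj hJ y (g k)) ∧
        IsJointRestriction ρ := by
  obtain ⟨m, σ, sl, sr, hσ⟩ := hP hI hJ hK f g x y n
  refine ⟨m, fun k => σ ≫ P.proCell hK n k, fun k => ?_, fun k => ?_,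
    (P.isJointRestriction_proCell hK n).restrict hσ⟩
  · rw [left_comp, sl, left_proCell]; exact P.structureArrow_proj hI hK f x k
  · rw [right_comp, sr, right_proCell]; exact P.structureArrow_proj hJ hK g y k

end LaxParallelProducts

end Parallel

/-! ### Products indexed by spans -/

section SpanProducts

variable {κ : IndexSize} {D : Type u} [DoubleCategory.{c, p, v} D]

theorem IndexSize.admits_of_surjective {I J : Type w} (f : I → J) (hf : Function.Surjective f) :
    ∀ {κ : IndexSize}, κ.Admits I → κ.Admits J
  | .small, _ => trivial
  | .finite, h => have : Finite I := h; Finite.of_surjective f hf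

theorem isPseudo_singleton : (singleton.{w} κ D).IsPseudo := by
  refine ⟨fun {x y z} m n => ?_, fun x => ?_⟩
  · let inv : FamCell (.mk (FamPro.singleton.{w} κ (pcomp m n)))
        (.mk ((FamPro.singleton.{w} κ m).comp (FamPro.singleton.{w} κ n))) :=
      { left := 𝟙 _
        right := 𝟙 _
        idx := fun _ => PUnit.unit
        cell := fun _ => 𝟙 (Proarrow.mk (pcomp m n))
        left_cell := fun _ => left_id (Proarrow.mk (pcomp m n))
        right_cell := fun _ => right_id (Proarrow.mk (pcomp m n)) }
    exact ⟨inv, FamCell.ext (Category.id_comp _) (Category.id_comp _) (fun _ _ _ => HEq.rfl)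
      fun _ _ _ => heq_of_eq (Category.id_comp (𝟙 (Proarrow.mk (pcomp m n)))),
      FamCell.ext (Category.id_comp _) (Category.id_comp _) (fun _ _ _ => HEq.rfl)
      fun _ _ _ => heq_of_eq (Category.id_comp (𝟙 (Proarrow.mk (pcomp m n))))⟩
  · let inv : FamCell (.mk (FamPro.singleton.{w} κ (unit x)))
        (.mk (FamPro.unit (FamOp.singleton.{w} κ x))) :=
      { left := 𝟙 _
        right := 𝟙 _
        idx := fun _ => PUnit.unit
        cell := fun b => match b with
          | .refl _ => 𝟙 (Proarrow.mk (unit x))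
        left_cell := fun b => match b with
          | .refl _ => left_id (Proarrow.mk (unit x))
        right_cell := fun b => match b with
          | .refl _ => right_id (Proarrow.mk (unit x)) }
    refine ⟨inv, FamCell.ext (Category.id_comp _) (Category.id_comp _) ?_ ?_,
      FamCell.ext (Category.id_comp _) (Category.id_comp _) (fun _ _ _ => HEq.rfl)
      fun _ _ _ => heq_of_eq (Category.id_comp (𝟙 (Proarrow.mk (unit x))))⟩
    · rintro _ _ ⟨⟩
      exact HEq.rfl
    · rintro _ _ ⟨⟩
      exact heq_of_eq (Category.id_comp (𝟙 (Proarrow.mk (unit x))))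

/-- Arrows out of a singleton family are determined by their components, since functions to the
singleton set are unique. -/
theorem FamHom.singleton_ext_iff {x : D} {X : FamOp.{w} κ D}
    {F G : FamHom (FamOp.singleton.{w} κ x) X} :
    F = G ↔ ∀ i, (F.map i : x ⟶ X.obj i) = G.map i :=
  ⟨by rintro rfl; exact fun _ => rfl,
    fun h => FamHom.ext (funext fun _ => rfl) (heq_of_eq (funext h))⟩

/-- Equality of cells from a singleton family, in terms of their components. -/
theorem FamCell.singleton_ext_iff {x y : D} {m : Pro x y} {X Y : FamOp.{w} κ D} {M : FamPro X Y}
    {α β : FamCell (.mk (FamPro.singleton.{w} κ m)) (.mk M)} :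
    α = β ↔ (∀ i, (α.left.map i : x ⟶ X.obj i) = β.left.map i) ∧
      (∀ j, (α.right.map j : y ⟶ Y.obj j) = β.right.map j) ∧
      ∀ {i j} (b : M.idx i j), (α.cell b : Proarrow.mk m ⟶ Proarrow.mk (M.pro b)) = β.cell b := by
  constructor
  · rintro rfl
    exact ⟨fun _ => rfl, fun _ => rfl, fun _ => rfl⟩
  · rintro ⟨h₁, h₂, h₃⟩
    exact FamCell.ext (FamHom.singleton_ext_iff.2 h₁) (FamHom.singleton_ext_iff.2 h₂)
      (fun _ _ _ => HEq.rfl) fun _ _ b => heq_of_eq (h₃ b)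

/-- Components of equal cells are equal; the equality is heterogeneous because the domain of a
component depends on the map of spans. -/
theorem FamCell.heq_cell {M N : Proarrow (FamOp.{w} κ D)} {α β : FamCell M N} (h : α = β)
    {k : N.src.Idx} {l : N.tgt.Idx} (b : N.pro.idx k l) : α.cell b ≍ β.cell b :=
  h ▸ HEq.rfl

/-- Products of objects and jointly cartesian families over them, for all spans of sets, are
universal arrows and cells from the double functor of singleton families. -/
def singletonUniversalCells (obj : FamOp.{w} κ D → D)
    (π : ∀ (X : FamOp.{w} κ D) (i : X.Idx), obj X ⟶ X.obj i)
    (hπ : ∀ X : FamOp.{w} κ D, IsProductCone (π X))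
    (pro : ∀ {X Y : FamOp.{w} κ D}, FamPro X Y → Pro (obj X) (obj Y))
    (ρ : ∀ {X Y : FamOp.{w} κ D} (M : FamPro X Y) (a : Apex M.idx),
      Proarrow.mk (pro M) ⟶ Proarrow.mk (M.pro a.2.2))
    (hl : ∀ {X Y : FamOp.{w} κ D} (M : FamPro X Y) (a : Apex M.idx), left (ρ M a) = π X a.1)
    (hr : ∀ {X Y : FamOp.{w} κ D} (M : FamPro X Y) (a : Apex M.idx), right (ρ M a) = π Y a.2.1)
    (hρ : ∀ {X Y : FamOp.{w} κ D} (M : FamPro X Y), IsJointRestriction (ρ M)) :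
    UniversalCells (singleton.{w} κ D) where
  obj := obj
  counit X := ⟨fun _ => PUnit.unit, π X⟩
  existsUnique_lift {x X} f := by
    obtain ⟨g, hg, hu⟩ := hπ X x f.map
    exact ⟨g, FamHom.singleton_ext_iff.2 hg, fun g' hg' =>
      hu g' (FamHom.singleton_ext_iff.1 hg')⟩
  pro M := pro M
  counitCell M :=
    { left := ⟨fun _ => PUnit.unit, π _⟩
      right := ⟨fun _ => PUnit.unit, π _⟩
      idx := fun _ => PUnit.unit
      cell := fun b => ρ M ⟨_, _, b⟩
      left_cell := fun _ => hl M _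
      right_cell := fun _ => hr M _ }
  left_counitCell _ := rfl
  right_counitCell _ := rfl
  existsUnique_liftCell {x y X Y m M} β := by
    obtain ⟨α, ⟨h₁, h₂, h₃⟩, hu⟩ := (IsJointRestriction.iff_of_isProductCone (hπ X) (hπ Y)
      (hl M) (hr M)).1 (hρ M) (.mk m) β.left.map β.right.map (fun a => β.cell a.2.2)
      (fun a => β.left_cell a.2.2) fun a => β.right_cell a.2.2
    refine ⟨α, FamCell.singleton_ext_iff.2 ⟨h₁, h₂, fun b => h₃ ⟨_, _, b⟩⟩, fun α' h => ?_⟩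
    obtain ⟨e₁, e₂, e₃⟩ := FamCell.singleton_ext_iff.1 h
    exact hu α' ⟨e₁, e₂, fun a => e₃ a.2.2⟩

/-- The span of sets with apex `K` and legs `f` and `g`. -/
inductive LegSpan {I J K : Type w} (f : K → I) (g : K → J) : I → J → Type w
  | mk (k : K) : LegSpan f g (f k) (g k)

theorem LegSpan.bijective_mk {I J K : Type w} (f : K → I) (g : K → J) :
    Function.Bijective fun k : K => (⟨f k, g k, .mk k⟩ : Apex (LegSpan f g)) := by
  constructor
  · intro k l h
    let apex : Apex (LegSpan f g) → K := fun
      | ⟨_, _, .mk k⟩ => k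
    exact congrArg apex h
  · rintro ⟨_, _, ⟨k⟩⟩
    exact ⟨k, rfl⟩

/-- The family of proarrows over a span of sets given by its legs. -/
def LegSpan.pro {I J K : Type w} {f : K → I} {g : K → J} {x : I → D} {y : J → D}
    (n : ∀ k, Pro (x (f k)) (y (g k))) : ∀ {i : I} {j : J}, LegSpan f g i j → Pro (x i) (y j)
  | _, _, .mk k => n k

/-- The proarrow of families over a span of sets given by its legs. -/
abbrev FamPro.ofLegs {X Y : FamOp.{w} κ D} {K : Type w} (hK : κ.Admits K) {f : K → X.Idx}
    {g : K → Y.Idx} (n : ∀ k, Pro (X.obj (f k)) (Y.obj (g k))) : FamPro X Y where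
  idx := LegSpan f g
  admits := IndexSize.admits_of_surjective _ (LegSpan.bijective_mk f g).surjective hK
  pro := LegSpan.pro n

namespace LaxProducts

variable (Q : LaxProducts.{w} κ D)

/-- The projections of the product of a family of objects. -/
def proj (X : FamOp.{w} κ D) (i : X.Idx) : Q.functor.obj X ⟶ X.obj i :=
  (Q.adj.counit.app X).map i

theorem isProductCone_proj (X : FamOp.{w} κ D) : IsProductCone (proj Q X) := by
  intro y f
  obtain ⟨g, hg, hu⟩ := LaxRightAdjoint.existsUnique_lift Q (x := y) (y := X)
    ⟨fun _ => PUnit.unit, f⟩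
  exact ⟨g, FamHom.singleton_ext_iff.1 hg, fun g' hg' => hu g' (FamHom.singleton_ext_iff.2 hg')⟩

variable {X Y Z : FamOp.{w} κ D}

/-- The projection cells of the product of a family of proarrows. -/
def proCell (M : FamPro X Y) {i : X.Idx} {j : Y.Idx} (a : M.idx i j) :
    Proarrow.mk (Q.functor.pro M) ⟶ Proarrow.mk (M.pro a) :=
  (Q.adj.counit.cell M).cell a

theorem left_counit_map (M : FamPro X Y) (i : X.Idx) :
    ((Q.adj.counit.cell M).left.map i : Q.functor.obj X ⟶ X.obj i) = proj Q X i :=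
  FamHom.singleton_ext_iff.1 (Q.adj.counit.left_cell M) i

theorem right_counit_map (M : FamPro X Y) (j : Y.Idx) :
    ((Q.adj.counit.cell M).right.map j : Q.functor.obj Y ⟶ Y.obj j) = proj Q Y j :=
  FamHom.singleton_ext_iff.1 (Q.adj.counit.right_cell M) j

theorem left_proCell (M : FamPro X Y) {i : X.Idx} {j : Y.Idx} (a : M.idx i j) :
    left (proCell Q M a) = proj Q X i :=
  ((Q.adj.counit.cell M).left_cell a).trans (left_counit_map Q M i)

theorem right_proCell (M : FamPro X Y) {i : X.Idx} {j : Y.Idx} (a : M.idx i j) :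
    right (proCell Q M a) = proj Q Y j :=
  ((Q.adj.counit.cell M).right_cell a).trans (right_counit_map Q M j)

theorem isJointRestriction_proCell (M : FamPro X Y) :
    IsJointRestriction fun a : Apex M.idx => proCell Q M a.2.2 := by
  refine (IsJointRestriction.iff_of_isProductCone (isProductCone_proj Q X)
    (isProductCone_proj Q Y) (f := fun a : Apex M.idx => a.1) (g := fun a => a.2.1)
    (fun a => left_proCell Q M a.2.2) fun a => right_proCell Q M a.2.2).2 ?_
  rintro ⟨q⟩ s t β hs ht
  obtain ⟨α, hα, hu⟩ := LaxRightAdjoint.existsUnique_liftCell Q (m := q) (n := M)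
    { left := ⟨fun _ => PUnit.unit, s⟩
      right := ⟨fun _ => PUnit.unit, t⟩
      idx := fun _ => PUnit.unit
      cell := fun b => β ⟨_, _, b⟩
      left_cell := fun b => hs ⟨_, _, b⟩
      right_cell := fun b => ht ⟨_, _, b⟩ }
  have h : ∀ α' : Proarrow.mk q ⟶ Proarrow.mk (Q.functor.pro M), _ ↔ _ := fun α' =>
    FamCell.singleton_ext_iff (α := (FamCell.singleton κ α' ≫ Q.adj.counit.cell M))
      (β := ⟨⟨fun _ => PUnit.unit, s⟩, ⟨fun _ => PUnit.unit, t⟩, fun _ => PUnit.unit,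
        fun b => β ⟨_, _, b⟩, fun b => hs ⟨_, _, b⟩, fun b => ht ⟨_, _, b⟩⟩)
  refine ⟨α, ⟨fun i => ?_, fun j => ?_, fun a => ((h α).1 hα).2.2 a.2.2⟩, fun α' h' =>
    hu α' ((h α').2 ⟨fun i => ?_, fun j => ?_, fun b => h'.2.2 ⟨_, _, b⟩⟩)⟩
  · rw [← left_counit_map Q M]
    exact ((h α).1 hα).1 i
  · rw [← right_counit_map Q M]
    exact ((h α).1 hα).2.1 j
  · exact (congrArg (left α' ≫ ·) (left_counit_map Q M i)).trans (h'.1 i)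
  · exact (congrArg (right α' ≫ ·) (right_counit_map Q M j)).trans (h'.2.1 j)

/-- Products of families of proarrows give jointly cartesian families over projections, indexed by
arbitrary spans. -/
theorem exists_isJointRestriction (X Y : FamOp.{w} κ D) {K : Type w} (hK : κ.Admits K)
    (f : K → X.Idx) (g : K → Y.Idx) (n : ∀ k, Pro (X.obj (f k)) (Y.obj (g k))) :
    ∃ (m : Pro (Q.functor.obj X) (Q.functor.obj Y)) (ρ : ∀ k, Proarrow.mk m ⟶ Proarrow.mk (n k)),
      (∀ k, left (ρ k) = proj Q X (f k)) ∧ (∀ k, right (ρ k) = proj Q Y (g k)) ∧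
        IsJointRestriction ρ :=
  ⟨Q.functor.pro (FamPro.ofLegs hK n), fun k => proCell Q (FamPro.ofLegs hK n) (.mk k),
    fun _ => left_proCell Q _ _, fun _ => right_proCell Q _ _,
    (IsJointRestriction.reindex_iff _ (LegSpan.bijective_mk f g)).2
      (isJointRestriction_proCell Q (FamPro.ofLegs hK n))⟩

/-- The composition comparison cell of products is invertible exactly when the external composite
of the products is jointly cartesian over the composite span. -/
theorem isIso_laxator_iff (M : FamPro X Y) (N : FamPro Y Z) :
    IsIso (Q.functor.laxator M N) ↔
      IsJointRestriction fun t : Apex (CompSpan M.idx N.idx) =>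
        hcomp (proCell Q M t.2.2.2.1) (proCell Q N t.2.2.2.2) (by
          rw [left_proCell, right_proCell]) := by
  rw [(isJointRestriction_proCell Q (M.comp N)).isIso_iff (Q.functor.left_laxator M N)
    (Q.functor.right_laxator M N)]
  have h : ∀ t : Apex (CompSpan M.idx N.idx),
      Q.functor.laxator M N ≫ proCell Q (M.comp N) t.2.2 =
        hcomp (proCell Q M t.2.2.2.1) (proCell Q N t.2.2.2.2) (by
          rw [left_proCell, right_proCell]) := by
    rintro ⟨i, k, j, a, b⟩
    -- the replacement of the left boundary in the definition of `FamCell.hcomp` has no effect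
    have hN : ∀ (F : FamOp.singleton.{w} κ (Q.functor.obj Y) ⟶ Y)
        (e : F = (Q.adj.counit.cell N).left),
        ((Q.adj.counit.cell N).withLeft F e).cell b = proCell Q N b := by
      rintro _ rfl
      rfl
    have e := FamCell.heq_cell (LaxRightAdjoint.laxator_counit Q M N)
      (⟨j, a, b⟩ : CompSpan M.idx N.idx i k)
    exact (Category.id_comp _).symm.trans ((eq_of_heq e).trans (hcomp_congr rfl (hN _ _)))
  rw [funext h]

theorem isIso_laxUnit_iff (X : FamOp.{w} κ D) :
    IsIso (Q.functor.laxUnit X) ↔ IsJointRestriction fun i => unitCell (proj Q X i) := by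
  rw [(isJointRestriction_proCell Q (FamPro.unit X)).isIso_iff (Q.functor.left_laxUnit X)
    (Q.functor.right_laxUnit X)]
  have hb : Function.Bijective fun i : X.Idx => (⟨i, i, .refl i⟩ : Apex (IdSpan X.Idx)) :=
    ⟨fun _ _ h => congrArg Sigma.fst h, by rintro ⟨i, _, ⟨⟩⟩; exact ⟨i, rfl⟩⟩
  rw [← IsJointRestriction.reindex_iff _ hb]
  have h : ∀ i, Q.functor.laxUnit X ≫ proCell Q (FamPro.unit X) (.refl i) =
      unitCell (proj Q X i) := fun i => by
    have e := FamCell.heq_cell (LaxRightAdjoint.laxUnit_counit Q X) (IdSpan.refl i)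
    exact (Category.id_comp _).symm.trans (eq_of_heq e)
  rw [← funext h]
  rfl

end LaxProducts

end SpanProducts

/-! ### Products from parallel products and conversely -/

section Comparison

variable {κ : IndexSize} {D : Type u} [DoubleCategory.{c, p, v} D]

/-- Lax products restrict to lax parallel products, which then have restrictions along structure
arrows: these are the products indexed by spans. -/
theorem LaxProducts.exists_laxParallelProducts (Q : LaxProducts.{w} κ D) :
    ∃ P : LaxParallelProducts.{w} κ D, P.HasStructureRestrictions := by
  have h (I : Type w) (hI : κ.Admits I) (x y : I → D) (n : ∀ i, Pro (x i) (y i)) :=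
    exists_isJointRestriction Q ⟨I, hI, x⟩ ⟨I, hI, y⟩ hI id id n
  choose pro ρ hl hr hρ using h
  let P : LaxParallelProducts.{w} κ D := fun I hI =>
    (diagonalUniversalCells (fun x => Q.functor.obj ⟨I, hI, x⟩) (fun x => proj Q ⟨I, hI, x⟩)
      (fun x => isProductCone_proj Q ⟨I, hI, x⟩) (pro I hI _ _) (ρ I hI _ _) (hl I hI _ _)
      (hr I hI _ _) (hρ I hI _ _)).laxRightAdjoint (isPseudo_diagonal I)
  refine ⟨P, fun {I J K} hI hJ hK f g x y n => ?_⟩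
  obtain ⟨m, σ, sl, sr, hσ⟩ := exists_isJointRestriction Q ⟨I, hI, x⟩ ⟨J, hJ, y⟩ hK f g n
  exact P.hasRestriction_of_isJointRestriction hI hJ hK (m := m) hσ sl sr

/-- Lax parallel products with restrictions along structure arrows extend to lax products: the
product of a family of proarrows is the restriction of its parallel product over the apex along
the structure arrows of the two legs. -/
theorem LaxParallelProducts.HasStructureRestrictions.hasLaxProducts
    {P : LaxParallelProducts.{w} κ D} (hP : P.HasStructureRestrictions) :
    HasLaxProducts.{w} κ D := by
  have h (X Y : FamOp.{w} κ D) (M : FamPro X Y) :=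
    hP.exists_isJointRestriction X.admits Y.admits M.admits (leftLeg M.idx) (rightLeg M.idx)
      X.obj Y.obj fun a => M.pro a.2.2
  choose pro ρ hl hr hρ using h
  exact ⟨(singletonUniversalCells (fun X => P.prod X.admits X.obj)
    (fun X => P.proj X.admits X.obj) (fun X => P.isProductCone_proj X.admits X.obj)
    (fun M => pro _ _ M) (fun M => ρ _ _ M) (fun M => hl _ _ M) (fun M => hr _ _ M)
    (fun M => hρ _ _ M)).laxRightAdjoint isPseudo_singleton⟩

theorem LaxProducts.IsIsoStrong.isStrong {Q : LaxProducts.{w} κ D}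
    (hQ : LaxProducts.IsIsoStrong Q) (P : LaxParallelProducts.{w} κ D) : P.IsStrong := by
  intro I hI
  refine ⟨fun {x y z} m n => ?_, fun x => ?_⟩
  · -- the external composite of the corresponding families over identity spans
    have bl : Function.Bijective (leftLeg (LegSpan (id : I → I) id)) :=
      (Function.Bijective.of_comp_iff _ (LegSpan.bijective_mk (id : I → I) id)).1
        Function.bijective_id
    have br : Function.Bijective (rightLeg (LegSpan (id : I → I) id)) :=
      (Function.Bijective.of_comp_iff _ (LegSpan.bijective_mk (id : I → I) id)).1
        Function.bijective_id
    let M : FamPro (⟨I, hI, x⟩ : FamOp.{w} κ D) ⟨I, hI, y⟩ := .ofLegs hI (f := id) (g := id) m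
    let N : FamPro (⟨I, hI, y⟩ : FamOp.{w} κ D) ⟨I, hI, z⟩ := .ofLegs hI (f := id) (g := id) n
    have H := (isIso_laxator_iff Q M N).1 (hQ.1 M N br bl)
    have hb : Function.Bijective fun i : I =>
        (⟨i, i, i, .mk i, .mk i⟩ : Apex (CompSpan M.idx N.idx)) :=
      ⟨fun _ _ e => congrArg Sigma.fst e, by rintro ⟨_, _, _, ⟨i⟩, ⟨_⟩⟩; exact ⟨i, rfl⟩⟩
    have HM := (IsJointRestriction.reindex_iff _ (LegSpan.bijective_mk id id)).2
      (isJointRestriction_proCell Q M)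
    have HN := (IsJointRestriction.reindex_iff _ (LegSpan.bijective_mk id id)).2
      (isJointRestriction_proCell Q N)
    exact (P.isIso_laxator_iff hI m n).2 <| IsJointRestriction.hcomp_of_hcomp
      (P.isProductCone_proj hI x) (isProductCone_proj Q ⟨I, hI, x⟩)
      (P.isProductCone_proj hI y) (isProductCone_proj Q ⟨I, hI, y⟩)
      (P.isProductCone_proj hI z) (isProductCone_proj Q ⟨I, hI, z⟩)
      (P.isJointRestriction_proCell hI m) HM (P.isJointRestriction_proCell hI n) HN
      (P.left_proCell hI m) (P.right_proCell hI m)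
      (fun _ => left_proCell Q M _) (fun _ => right_proCell Q M _)
      (P.left_proCell hI n) (P.right_proCell hI n)
      (fun _ => left_proCell Q N _) (fun _ => right_proCell Q N _)
      ((IsJointRestriction.reindex_iff _ hb).2 H)
  · exact (P.isIso_laxUnit_iff hI x).2 (IsJointRestriction.unitCell_of_unitCell
      (P.isProductCone_proj hI x) (isProductCone_proj Q ⟨I, hI, x⟩)
      ((isIso_laxUnit_iff Q ⟨I, hI, x⟩).1 (hQ.2 _)))

/-- A span whose right leg is bijective is given by a function in the other direction. -/
theorem exists_section_of_bijective_rightLeg {I J : Type w} {A : I → J → Type w}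
    (h : Function.Bijective (rightLeg A)) :
    ∃ (f : J → I) (a : ∀ j, A (f j) j), Function.Bijective fun j => (⟨f j, j, a j⟩ : Apex A) := by
  have (j : J) : ∃ (i : I) (a : A i j), True := by
    obtain ⟨⟨i, _, a⟩, rfl⟩ := h.surjective j
    exact ⟨i, a, trivial⟩
  choose f a _ using this
  exact ⟨f, a, (Function.Bijective.of_comp_iff' h _).1 Function.bijective_id⟩

theorem exists_section_of_bijective_leftLeg {I J : Type w} {A : I → J → Type w}
    (h : Function.Bijective (leftLeg A)) :
    ∃ (g : I → J) (a : ∀ i, A i (g i)), Function.Bijective fun i => (⟨i, g i, a i⟩ : Apex A) := by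
  have (i : I) : ∃ (j : J) (a : A i j), True := by
    obtain ⟨⟨_, j, a⟩, rfl⟩ := h.surjective i
    exact ⟨j, a, trivial⟩
  choose g a _ using this
  exact ⟨g, a, (Function.Bijective.of_comp_iff' h _).1 Function.bijective_id⟩

/-- If the parallel products are strong, then identity proarrows on products are parallel products
of identity proarrows. -/
theorem LaxParallelProducts.IsStrong.isJointRestriction_unitCell
    {P : LaxParallelProducts.{w} κ D} (hP : P.IsStrong) (Q : LaxProducts.{w} κ D)
    (X : FamOp.{w} κ D) : IsJointRestriction fun i => unitCell (LaxProducts.proj Q X i) :=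
  IsJointRestriction.unitCell_of_unitCell (LaxProducts.isProductCone_proj Q X)
    (P.isProductCone_proj X.admits X.obj)
    ((P.isIso_laxUnit_iff X.admits X.obj).1 ((hP X.Idx X.admits).2 X.obj))

/-- If the parallel products are strong, then reindexing arrows between products have companions
and conjoints, so that restriction along them commutes with external composition. -/
theorem LaxParallelProducts.IsStrong.isIsoStrong {P : LaxParallelProducts.{w} κ D}
    (hP : P.IsStrong) (Q : LaxProducts.{w} κ D) : LaxProducts.IsIsoStrong Q := by
  refine ⟨fun {X Y Z} M N hM hN => ?_, fun X =>
    (LaxProducts.isIso_laxUnit_iff Q X).2 (hP.isJointRestriction_unitCell Q X)⟩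
  obtain ⟨f, a, ha⟩ := exists_section_of_bijective_rightLeg hM
  obtain ⟨g, b, hb⟩ := exists_section_of_bijective_leftLeg hN
  -- `M` and `N` are reindexed to parallel families `m`, `n` over the index set of `Y`
  let X' : FamOp.{w} κ D := ⟨Y.Idx, Y.admits, fun j => X.obj (f j)⟩
  let Z' : FamOp.{w} κ D := ⟨Y.Idx, Y.admits, fun j => Z.obj (g j)⟩
  let m : ∀ j, Pro (X'.obj j) (Y.obj j) := fun j => M.pro (a j)
  let n : ∀ j, Pro (Y.obj j) (Z'.obj j) := fun j => N.pro (b j)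
  have hX := LaxProducts.isProductCone_proj Q X'
  have hY := LaxProducts.isProductCone_proj Q Y
  have hZ := LaxProducts.isProductCone_proj Q Z'
  obtain ⟨m', ρ, lρ, rρ, hρ⟩ := LaxProducts.exists_isJointRestriction Q X' Y Y.admits id id m
  obtain ⟨n', σ, lσ, rσ, hσ⟩ := LaxProducts.exists_isJointRestriction Q Y Z' Y.admits id id n
  -- the external composite of their parallel products is a parallel product
  have H : IsJointRestriction fun j => hcomp (ρ j) (σ j) (by rw [rρ, lσ]) :=
    IsJointRestriction.hcomp_of_hcomp hX (P.isProductCone_proj Y.admits X'.obj) hY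
      (P.isProductCone_proj Y.admits Y.obj) hZ (P.isProductCone_proj Y.admits Z'.obj) hρ
      (P.isJointRestriction_proCell Y.admits m) hσ (P.isJointRestriction_proCell Y.admits n)
      lρ rρ (P.left_proCell Y.admits m) (P.right_proCell Y.admits m) lσ rσ
      (P.left_proCell Y.admits n) (P.right_proCell Y.admits n)
      ((P.isIso_laxator_iff Y.admits m n).1 ((hP Y.Idx Y.admits).1 m n))
  -- the products of `M` and `N` are restrictions of them along reindexing arrows `F` and `G`
  obtain ⟨F, hF, -⟩ := hX (Q.functor.obj X) fun j => LaxProducts.proj Q X (f j)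
  obtain ⟨G, hG, -⟩ := hZ (Q.functor.obj Z) fun j => LaxProducts.proj Q Z (g j)
  obtain ⟨R, lR, rR, eR, hR⟩ := hρ.exists_isRestriction
    ((IsJointRestriction.reindex_iff _ ha).2 (LaxProducts.isJointRestriction_proCell Q M)) F
    (𝟙 (Q.functor.obj Y))
    (fun j => by rw [LaxProducts.left_proCell, lρ]; exact (hF j).symm)
    (fun j => by rw [LaxProducts.right_proCell, rρ]; exact (Category.id_comp _).symm)
  obtain ⟨S, lS, rS, eS, hS⟩ := hσ.exists_isRestriction
    ((IsJointRestriction.reindex_iff _ hb).2 (LaxProducts.isJointRestriction_proCell Q N))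
    (𝟙 (Q.functor.obj Y)) G
    (fun j => by rw [LaxProducts.left_proCell, lσ]; exact (Category.id_comp _).symm)
    (fun j => by rw [LaxProducts.right_proCell, rσ]; exact (hG j).symm)
  -- `F` has a companion and `G` has a conjoint: products of identity proarrows over spans
  obtain ⟨k, γ, lγ, rγ, hγ⟩ := LaxProducts.exists_isJointRestriction Q X X' Y.admits f id
    fun j => unit (X.obj (f j))
  obtain ⟨ε, lε, rε, -, hε⟩ := (hP.isJointRestriction_unitCell Q X').exists_isRestriction hγ F
    (𝟙 (Q.functor.obj X'))
    (fun j => by rw [lγ, left_unitCell]; exact (hF j).symm)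
    (fun j => by rw [rγ, right_unitCell]; exact (Category.id_comp _).symm)
  obtain ⟨l, δ, lδ, rδ, hδ⟩ := LaxProducts.exists_isJointRestriction Q Z' Z Y.admits id g
    fun j => unit (Z.obj (g j))
  obtain ⟨ζ, lζ, rζ, -, hζ⟩ := (hP.isJointRestriction_unitCell Q Z').exists_isRestriction hδ
    (𝟙 (Q.functor.obj Z')) G
    (fun j => by rw [lδ, left_unitCell]; exact (Category.id_comp _).symm)
    (fun j => by rw [rδ, right_unitCell]; exact (hG j).symm)
  have hRS : IsRestriction (hcomp R S (by rw [rR, lS])) := by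
    have := (hε.hcomp_id lε rε hR lR rR (Q.functor.pro N)).comp
      (hζ.id_hcomp lζ rζ hS lS rS m')
    rw [← hcomp_comp] at this
    rwa [hcomp_congr (Category.comp_id R).symm (Category.id_comp S).symm]
  have e : Function.Bijective fun j =>
      (⟨f j, g j, j, a j, b j⟩ : Apex (CompSpan M.idx N.idx)) := by
    constructor
    · exact fun _ _ h => congrArg (fun t : Apex (CompSpan M.idx N.idx) => t.2.2.1) h
    · rintro ⟨i, k, j, a', b'⟩
      obtain ⟨j₁, h₁⟩ := ha.surjective ⟨i, j, a'⟩
      obtain ⟨j₂, h₂⟩ := hb.surjective ⟨j, k, b'⟩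
      cases h₁
      cases h₂
      exact ⟨_, rfl⟩
  refine (LaxProducts.isIso_laxator_iff Q M N).2 ((IsJointRestriction.reindex_iff _ e).1 ?_)
  convert H.restrict hRS using 2 with j
  rw [← hcomp_comp]
  exact hcomp_congr (eR j).symm (eS j).symm

end Comparison
end Dbl

theorem mainTheorem2 (κ : Dbl.IndexSize) (D : Type u) [Dbl.DoubleCategory.{c, p, v} D] :
    (Dbl.HasLaxProducts.{w} κ D ↔
      ∃ P : Dbl.LaxParallelProducts.{w} κ D, P.HasStructureRestrictions) ∧
    (∀ (Q : Dbl.LaxProducts.{w} κ D) (P : Dbl.LaxParallelProducts.{w} κ D),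
      Dbl.LaxProducts.IsIsoStrong Q ↔ P.IsStrong) ∧
    ((∃ Q : Dbl.LaxProducts.{w} κ D, Dbl.LaxProducts.IsIsoStrong Q) ↔
      ∃ P : Dbl.LaxParallelProducts.{w} κ D, P.IsStrong ∧ P.HasStructureRestrictions) := by
  refine ⟨⟨fun ⟨Q⟩ => Q.exists_laxParallelProducts, fun ⟨_, hP⟩ => hP.hasLaxProducts⟩,
    fun Q P => ⟨fun hQ => hQ.isStrong P, fun hP => hP.isIsoStrong Q⟩, ?_, ?_⟩
  · rintro ⟨Q, hQ⟩
    obtain ⟨P, hP⟩ := Q.exists_laxParallelProducts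
    exact ⟨P, hQ.isStrong P, hP⟩
  · rintro ⟨P, hs, hP⟩
    obtain ⟨Q⟩ := hP.hasLaxProducts
    exact ⟨Q, hs.isIsoStrong Q⟩
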